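/- Let $\Omega\subset\mathbb R^2$ be a bounded open polygonal domain with Lipschitz boundary (more generally, a bounded open set with $\Omega=\operatorname{int}\overline\Omega$), let $\mathcal T$ be a (finite, regular) simplicial triangulation of $\Omega$, and let $\ell\ge 4$ be even. For a triangle $T\in\mathcal T$ with vertices $p_1,p_2,p_3$ enumerated counter-clockwise (indices modulo $3$), let $\lambda_1,\lambda_2,\lambda_3$ be the barycentric coordinates, $F_i$ the edge with endpoints $p_{i-1},p_{i+1}$, $b_T=\lambda_1\lambda_2\lambda_3$ and $b_{F_i}=\lambda_{i-1}\lambda_{i+1}$. Let $\psi_i=\lambda_{i+1}^{\ell-3}+\sum_{k=0}^{\ell-4}c_k\lambda_{i+1}^k$, where the coefficients $c_k$ are determined by $$\int_{F_i}b_{F_i}^2\,\psi_i\,q\,ds=0\qquad\text{for all } q\in P_{\ell-4}(F_i),$$ and set $$\mathcal P_{T,\ell}=P_\ell(T)+\operatorname{span}\{b_T\,b_{F_i}\,\psi_i : i=1,2,3\}.$$ Here $P_k(G)$ denotes the polynomial functions of degree at most $k$ on $G$. For an interior edge $F$ shared by the triangles $T_+$ and $T_-$, with unit normal $n$ pointing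 from $T_+$ towards $T_-$, let $[\partial_n v]=\partial_n(v|_{T_+})-\partial_n(v|_{T_-})$ on $F$. Let $V^{(\ell)}_{\mathcal T}$ be the space of all $v\in H^1_0(\Omega)$ such that $v|_T\in\mathcal P_{T,\ell}$ for all $T\in\mathcal T$, $\nabla v$ is continuous at all vertices of $\mathcal T$ (i.e. at each vertex the gradients of $v|_T$ coincide for all triangles $T\in\mathcal T$ containing it), and $$\int_F[\partial_n v]\,q\,ds=0\qquad\text{for all interior edges } F \text{ and all } q\in P_{\ell-3}(F).$$ Then the following hold. 1. Every $v_h\in V^{(\ell)}_{\mathcal T}$ satisfies, for every interior edge $F$, $$\int_F[\partial_n v_h]\,q\,ds=0\qquad\text{for all } q\in P_{\ell-2}(F).$$ 2. The space $V^{(\ell)}_{\mathcal T}$ has the strong discrete Miranda–Talenti property: for all $v_h\in V^{(\ell)}_{\mathcal T}$, $$\|D^2_{\mathcal T}v_h\|_{L^2(\Omega)}\le\|\Delta_{\mathcal T}v_h\|_{L^2(\Omega)},$$ where $D^2_{\mathcal T}v_h$ (with the Frobenius norm) and $\Delta_{\mathcal T}v_h$ are the Hessian and the Laplacian of $v_h$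 evaluated piecewise on the triangles of $\mathcal T$. -/

import Mathlib

open MeasureTheory Filter Topology
open scoped ContDiff ENNReal

noncomputable section

namespace MirandaTalenti

/-- The Euclidean plane `ℝ²`. -/
abbrev Plane : Type := EuclideanSpace ℝ (Fin 2)

/-! ### Polynomials, Sobolev space, edge integrals -/

/-- Evaluation of bivariate polynomials, as a linear map to functions on the plane. -/
def evalMap : MvPolynomial (Fin 2) ℝ →ₗ[ℝ] (Plane → ℝ) :=
  LinearMap.pi fun x => (MvPolynomial.aeval fun i => x i).toLinearMap

/-- `P_k`: polynomial functions of total degree at most `k`. For a triangle or an edge `G`, the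
space `P_k(G)` consists of the restrictions to `G` of the members of `P_k`. -/
def polySpace (k : ℕ) : Submodule ℝ (Plane → ℝ) :=
  (MvPolynomial.restrictTotalDegree (Fin 2) ℝ k).map evalMap

theorem mem_polySpace {k : ℕ} {p : Plane → ℝ} :
    p ∈ polySpace k ↔ ∃ q : MvPolynomial (Fin 2) ℝ, q.totalDegree ≤ k ∧
      ∀ x : Plane, p x = MvPolynomial.eval (fun i => x i) q := by
  constructor
  · rintro ⟨q, hq, rfl⟩
    refine ⟨q, (MvPolynomial.mem_restrictTotalDegree _ _ _).1 hq, fun x => ?_⟩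
    simp [evalMap, MvPolynomial.aeval_eq_eval]
  · rintro ⟨q, hq, h⟩
    refine ⟨q, (MvPolynomial.mem_restrictTotalDegree _ _ _).2 hq, ?_⟩
    funext x
    simp [evalMap, MvPolynomial.aeval_eq_eval, h x]

/-- `v ∈ H¹₀(Ω)`: the function `v` is the limit in `H¹(Ω)` of smooth functions with compact support
in `Ω`. The field `g` is the weak gradient of `v`. (Only the values of `v` on `Ω`, up to null sets,
matter.) -/
def MemH10 (Ω : Set Plane) (v : Plane → ℝ) : Prop :=
  MemLp v 2 (volume.restrict Ω) ∧
  ∃ g : Plane → Plane, MemLp g 2 (volume.restrict Ω) ∧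
  ∃ φ : ℕ → Plane → ℝ,
    (∀ n, ContDiff ℝ ∞ (φ n) ∧ HasCompactSupport (φ n) ∧ tsupport (φ n) ⊆ Ω) ∧
    Tendsto (fun n => eLpNorm (fun x => φ n x - v x) 2 (volume.restrict Ω)) atTop (𝓝 0) ∧
    Tendsto (fun n => eLpNorm (fun x => gradient (φ n) x - g x) 2 (volume.restrict Ω))
      atTop (𝓝 0)

/-- `∫_F f ds` over the edge `F` with endpoints `a` and `b`, with respect to arc length. -/
def edgeIntegral (a b : Plane) (f : Plane → ℝ) : ℝ :=
  dist a b * ∫ t in (0 : ℝ)..1, f (AffineMap.lineMap a b t)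

/-! ### The shape functions on one triangle -/

/-- The vertices of the nondegenerate triangle `T` (an affine basis of the plane, indexed modulo 3)
are enumerated counter-clockwise. The barycentric coordinate `λ_i` of `T` is `T.coord i`. -/
def IsCounterClockwise (T : AffineBasis (Fin 3) ℝ Plane) : Prop :=
  0 < (T 1 - T 0) 0 * (T 2 - T 0) 1 - (T 1 - T 0) 1 * (T 2 - T 0) 0

/-- The cubic volume bubble `b_T = λ_0 λ_1 λ_2`. -/
def volumeBubble (T : AffineBasis (Fin 3) ℝ Plane) (x : Plane) : ℝ :=
  ∏ i, T.coord i x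

/-- The quadratic bubble `b_{F_i} = λ_{i-1} λ_{i+1}` of the edge `F_i` opposite to vertex `i`. -/
def edgeBubble (T : AffineBasis (Fin 3) ℝ Plane) (i : Fin 3) (x : Plane) : ℝ :=
  T.coord (i - 1) x * T.coord (i + 1) x

/-- `ψ` is the function `ψ_i = λ_{i+1}^{ℓ-3} + ∑_{k ≤ ℓ-4} c_k λ_{i+1}^k` whose coefficients are
determined by `∫_{F_i} b_{F_i}² ψ_i q ds = 0` for all `q ∈ P_{ℓ-4}(F_i)`. For `ℓ ≥ 4` there is
exactly one such function. -/
def IsEdgePolynomial (ℓ : ℕ) (T : AffineBasis (Fin 3) ℝ Plane) (i : Fin 3) (ψ : Plane → ℝ) :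
    Prop :=
  (∃ c : ℕ → ℝ, ∀ x, ψ x = T.coord (i + 1) x ^ (ℓ - 3) +
      ∑ k ∈ Finset.range (ℓ - 3), c k * T.coord (i + 1) x ^ k) ∧
  ∀ q ∈ polySpace (ℓ - 4),
    edgeIntegral (T (i - 1)) (T (i + 1)) (fun x => edgeBubble T i x ^ 2 * ψ x * q x) = 0

/-- `f` is one of the bubble functions `ψ_i^B = b_T b_{F_i} ψ_i` of the triangle whose set of
vertices is `s`. (The three counter-clockwise enumerations of `s` yield the same three
functions.) -/
def IsBubble (ℓ : ℕ) (s : Finset Plane) (f : Plane → ℝ) : Prop :=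
  ∃ T : AffineBasis (Fin 3) ℝ Plane, Set.range T = (s : Set Plane) ∧ IsCounterClockwise T ∧
    ∃ (i : Fin 3) (ψ : Plane → ℝ), IsEdgePolynomial ℓ T i ψ ∧
      ∀ x, f x = volumeBubble T x * edgeBubble T i x * ψ x

/-- The shape function space `P_{T,ℓ} = P_ℓ(T) + span {ψ_i^B}` of the triangle with vertices `s`. -/
def shapeSpace (ℓ : ℕ) (s : Finset Plane) : Submodule ℝ (Plane → ℝ) :=
  polySpace ℓ ⊔ Submodule.span ℝ {f | IsBubble ℓ s f}

/-! ### Piecewise polynomial functions -/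

/-- The function `v` agrees with `p` on the triangle with vertices `s` (up to a null set). -/
def AgreesOn (s : Finset Plane) (v p : Plane → ℝ) : Prop :=
  v =ᵐ[volume.restrict (convexHull ℝ (s : Set Plane))] p

open Classical in
/-- `v|_T` for a function `v` that is polynomial on the triangle `T` with vertices `s`: the
polynomial that agrees with `v` on `T`. -/
def piece (v : Plane → ℝ) (s : Finset Plane) : Plane → ℝ :=
  if h : ∃ p : Plane → ℝ, (∃ k, p ∈ polySpace k) ∧ AgreesOn s v p then h.choose else 0

/-- The Hessian of `p` at `x`, as a vector of its four entries; the Euclidean norm on this space is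
the Frobenius norm. -/
def hessian (p : Plane → ℝ) (x : Plane) : EuclideanSpace ℝ (Fin 2 × Fin 2) :=
  WithLp.toLp 2 fun ij => iteratedFDeriv ℝ 2 p x
    ![EuclideanSpace.single ij.1 1, EuclideanSpace.single ij.2 1]

/-- A simplicial triangulation of `Ω ⊆ ℝ²`: a finite geometric simplicial complex whose simplices
cover exactly the closure of `Ω`. -/
structure Triangulation (Ω : Set Plane) extends Geometry.SimplicialComplex ℝ Plane where
  finite_faces : faces.Finite
  space_eq : toSimplicialComplex.space = closure Ω

/-- `n` is the unit normal to the edge with endpoints `a` and `b` of the triangle with vertices `s`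
that points out of this triangle. -/
structure IsOutwardNormal (s : Finset Plane) (a b n : Plane) : Prop where
  norm_eq : ‖n‖ = 1
  orthogonal : inner ℝ n (b - a) = 0
  outward : ∀ x ∈ s, inner ℝ n (x - a) ≤ 0

/-- The normal derivative jump `∂_n v|_{T₊} - ∂_n v|_{T₋}`, where `s₁`, `s₂` are the sets of
vertices of `T₊`, `T₋`. -/
def normalJump (v : Plane → ℝ) (s₁ s₂ : Finset Plane) (n : Plane) (x : Plane) : ℝ :=
  fderiv ℝ (piece v s₁) x n - fderiv ℝ (piece v s₂) x n

namespace Triangulation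

variable {Ω : Set Plane} (𝒯 : Triangulation Ω)

/-- The elements (triangles) of the triangulation, given by their sets of vertices. -/
def elements : Finset (Finset Plane) := 𝒯.finite_faces.toFinset.filter fun s => s.card = 3

/-- The segment with distinct endpoints `a` and `b` is an interior edge, shared by the two distinct
elements with vertices `s₁` and `s₂`. -/
structure IsInteriorEdge (a b : Plane) (s₁ s₂ : Finset Plane) : Prop where
  ne : a ≠ b
  mem₁ : s₁ ∈ 𝒯.elements
  mem₂ : s₂ ∈ 𝒯.elements
  elements_ne : s₁ ≠ s₂
  left_mem₁ : a ∈ s₁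
  right_mem₁ : b ∈ s₁
  left_mem₂ : a ∈ s₂
  right_mem₂ : b ∈ s₂

/-- The normal derivative of `v` enjoys `k`th order moment continuity across every interior edge:
`∫_F [∂_n v] q ds = 0` for all interior edges `F` and all `q ∈ P_k(F)`. -/
def NormalMomentContinuity (k : ℕ) (v : Plane → ℝ) : Prop :=
  ∀ (a b : Plane) (s₁ s₂ : Finset Plane), 𝒯.IsInteriorEdge a b s₁ s₂ →
    ∀ n : Plane, IsOutwardNormal s₁ a b n →
      ∀ q ∈ polySpace k, edgeIntegral a b (fun x => normalJump v s₁ s₂ n x * q x) = 0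

/-- `∇v` is continuous at all vertices: at a common vertex the gradients from any two elements
coincide. -/
def GradientContinuousAtVertices (v : Plane → ℝ) : Prop :=
  ∀ s₁ ∈ 𝒯.elements, ∀ s₂ ∈ 𝒯.elements, ∀ z ∈ s₁, z ∈ s₂ →
    gradient (piece v s₁) z = gradient (piece v s₂) z

/-- The finite element space `V^{(ℓ)}`. -/
def feSpace (ℓ : ℕ) : Set (Plane → ℝ) :=
  {v | MemH10 Ω v ∧ (∀ s ∈ 𝒯.elements, ∃ p ∈ shapeSpace ℓ s, AgreesOn s v p) ∧
    𝒯.GradientContinuousAtVertices v ∧ 𝒯.NormalMomentContinuity (ℓ - 3) v}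

/-- The piecewise Hessian: the sum over all elements of the Hessian of `v|_T`, extended by zero. -/
def piecewiseHessian (v : Plane → ℝ) (x : Plane) : EuclideanSpace ℝ (Fin 2 × Fin 2) :=
  ∑ s ∈ 𝒯.elements,
    (interior (convexHull ℝ (s : Set Plane))).indicator (hessian (piece v s)) x

/-- The piecewise Laplacian: the sum over all elements of the Laplacian of `v|_T`, extended by
zero. -/
def piecewiseLaplacian (v : Plane → ℝ) (x : Plane) : ℝ :=
  ∑ s ∈ 𝒯.elements,
    (interior (convexHull ℝ (s : Set Plane))).indicator (Laplacian.laplacian (piece v s)) x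

/-- The strong discrete Miranda–Talenti property of a space `V` of piecewise polynomial functions:
`‖D²_𝒯 v‖ ≤ ‖Δ_𝒯 v‖` in `L²(Ω)` for all `v ∈ V`. -/
def StrongMirandaTalenti (V : Set (Plane → ℝ)) : Prop :=
  ∀ v ∈ V, eLpNorm (𝒯.piecewiseHessian v) 2 (volume.restrict Ω) ≤
    eLpNorm (𝒯.piecewiseLaplacian v) 2 (volume.restrict Ω)

end Triangulation

end MirandaTalenti

end

/-!
The jumps of normal derivatives are handled by a parity argument. On an interior edge, parametrized
by `t ∈ [0, 1]`, every normal derivative has the form `R + (t (1 - t))² S` with `deg R ≤ ℓ - 1` and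
a polynomial `S` of degree at most `ℓ - 3` that is orthogonal, for the weight `(t (1 - t))²`, to all
polynomials of lower degree (`HasEdgeForm`). Since the gradients agree at the vertices, the jump `J`
vanishes at the endpoints, and its polynomial part is `t (1 - t) R'`. Testing with polynomials of
degree at most `ℓ - 4` shows that `R'` is an orthogonal polynomial for the weight `t (1 - t)`. As
`ℓ - 3` is odd, both `R'` and `S` are odd about `1/2` (`eval_one_sub_of_orthogonal`). Hence `J` is
odd about `1/2`, and its moment against `(t - 1/2)^(ℓ - 2)` vanishes automatically
(`integral_mul_eq_zero_of_moments`).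

The Miranda–Talenti estimate is in fact an equality. The difference `|D²v|² - (Δv)²` equals
`-2 det D²v`, the divergence of a vector field, so its integral over a triangle is a sum of edge
terms (`integral_norm_hessian_sq_sub_laplacian_sq`). On an edge with direction `τ` and transversal
direction `n` the density of these terms is `∂_n v ∂_τ∂_τ v - ∂_τ v ∂_τ∂_n v`, up to a factor that
has opposite signs for the two triangles at an interior edge. These triangles have a common trace on
the edge, because `v ∈ H¹₀(Ω)` (`eq_of_ae_eq_on_strips`). Therefore, only the jump `J` of `∂_n v`
enters the sum of the two contributions. An integration by parts, without boundary terms as `J`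
vanishes at the vertices, turns this sum into a multiple of `∫ J ∂_τ∂_τ v`
(`edgeTerm_add_edgeTerm_eq_zero`). The bubble functions vanish on the edges, so `∂_τ∂_τ v` is a
polynomial of degree at most `ℓ - 2` there, and the first part of the theorem applies. On a boundary
edge the trace of `v` vanishes, and so does the edge term.
-/

noncomputable section

namespace MirandaTalenti

/-! ### Polynomial functions on the plane -/

theorem polySpace_mono {j k : ℕ} (h : j ≤ k) : polySpace j ≤ polySpace k := by
  intro p hp
  obtain ⟨q, hq, hp⟩ := mem_polySpace.1 hp
  exact mem_polySpace.2 ⟨q, hq.trans h, hp⟩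

theorem mul_mem_polySpace {j k : ℕ} {p q : Plane → ℝ} (hp : p ∈ polySpace j)
    (hq : q ∈ polySpace k) : (fun x => p x * q x) ∈ polySpace (j + k) := by
  obtain ⟨P, hP, hp⟩ := mem_polySpace.1 hp
  obtain ⟨Q, hQ, hq⟩ := mem_polySpace.1 hq
  exact mem_polySpace.2 ⟨P * Q, (MvPolynomial.totalDegree_mul P Q).trans (add_le_add hP hQ),
    fun x => by simp [hp x, hq x]⟩

theorem const_mem_polySpace (c : ℝ) : (fun _ => c) ∈ polySpace 0 :=
  mem_polySpace.2 ⟨MvPolynomial.C c, by simp, fun x => by simp⟩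

theorem pow_mem_polySpace {p : Plane → ℝ} (hp : p ∈ polySpace 1) (k : ℕ) :
    (fun x => p x ^ k) ∈ polySpace k := by
  induction k with
  | zero => simpa using const_mem_polySpace 1
  | succ k ih => simpa [pow_succ] using mul_mem_polySpace ih hp

theorem affine_mem_polySpace (f : Plane →ᵃ[ℝ] ℝ) : (f : Plane → ℝ) ∈ polySpace 1 := by
  have hf : ∀ x : Plane, f x = f.linear (EuclideanSpace.single 0 1) * x 0 +
      f.linear (EuclideanSpace.single 1 1) * x 1 + f 0 := by
    intro x
    have hx : x = x 0 • EuclideanSpace.single (0 : Fin 2) (1 : ℝ) +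
        x 1 • EuclideanSpace.single (1 : Fin 2) (1 : ℝ) := by
      ext i; fin_cases i <;> simp
    have h1 : f x = f.linear x + f 0 := congrFun f.decomp x
    have h2 : f.linear x = f.linear (x 0 • EuclideanSpace.single (0 : Fin 2) (1 : ℝ) +
        x 1 • EuclideanSpace.single (1 : Fin 2) (1 : ℝ)) := congrArg _ hx
    rw [h1, h2, map_add, map_smul, map_smul, smul_eq_mul, smul_eq_mul]
    ring
  refine mem_polySpace.2 ⟨MvPolynomial.C (f.linear (EuclideanSpace.single 0 1)) * MvPolynomial.X 0 +
    MvPolynomial.C (f.linear (EuclideanSpace.single 1 1)) * MvPolynomial.X 1 +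
    MvPolynomial.C (f 0), ?_, fun x => by simp [hf x]⟩
  have hC : ∀ (c : ℝ) (i : Fin 2), (MvPolynomial.C c * MvPolynomial.X i :
      MvPolynomial (Fin 2) ℝ).totalDegree ≤ 1 := fun c i =>
    (MvPolynomial.totalDegree_mul _ _).trans (by simp)
  refine (MvPolynomial.totalDegree_add _ _).trans (max_le ?_ (by simp))
  exact (MvPolynomial.totalDegree_add _ _).trans (max_le (hC _ _) (hC _ _))

theorem contDiff_eval (P : MvPolynomial (Fin 2) ℝ) {n : WithTop ℕ∞} :
    ContDiff ℝ n fun x : Plane => MvPolynomial.eval (fun i => x i) P := by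
  induction P using MvPolynomial.induction_on with
  | C a => simpa using contDiff_const
  | add P Q hP hQ => simpa using hP.add hQ
  | mul_X P i hP =>
    simp only [map_mul, MvPolynomial.eval_X]
    exact hP.mul (by fun_prop)

theorem contDiff_of_mem_polySpace {k : ℕ} {p : Plane → ℝ} (hp : p ∈ polySpace k) {n : WithTop ℕ∞} :
    ContDiff ℝ n p := by
  obtain ⟨P, -, hp⟩ := mem_polySpace.1 hp
  obtain rfl : p = fun x => MvPolynomial.eval (fun i => x i) P := funext hp
  exact contDiff_eval P

theorem fderiv_eval_apply (P : MvPolynomial (Fin 2) ℝ) (x e : Plane) :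
    fderiv ℝ (fun y : Plane => MvPolynomial.eval (fun i => y i) P) x e =
      ∑ i, e i * MvPolynomial.eval (fun i => x i) (MvPolynomial.pderiv i P) := by
  have hd : ∀ Q : MvPolynomial (Fin 2) ℝ,
      DifferentiableAt ℝ (fun y : Plane => MvPolynomial.eval (fun i => y i) Q) x := fun Q =>
    (contDiff_eval Q (n := 1)).differentiable (by simp) x
  induction P using MvPolynomial.induction_on with
  | C a => simp
  | add P Q hP hQ =>
    simp only [map_add]
    rw [fderiv_fun_add (hd P) (hd Q), add_apply, hP, hQ,
      ← Finset.sum_add_distrib]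
    simp only [mul_add]
  | mul_X P i hP =>
    simp only [map_mul, MvPolynomial.eval_X]
    have hi : HasFDerivAt (fun y : Plane => y i) (EuclideanSpace.proj i : Plane →L[ℝ] ℝ) x :=
      (EuclideanSpace.proj i : Plane →L[ℝ] ℝ).hasFDerivAt
    rw [fderiv_fun_mul (hd P) hi.differentiableAt, hi.fderiv]
    simp only [add_apply, smul_apply, hP, smul_eq_mul,
      MvPolynomial.pderiv_mul, MvPolynomial.pderiv_X, map_add, map_mul,
      MvPolynomial.eval_X, Fin.sum_univ_two]
    fin_cases i <;> simp <;> ring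

theorem totalDegree_pderiv_le {σ R : Type*} [CommSemiring R] (P : MvPolynomial σ R) (i : σ) :
    (MvPolynomial.pderiv i P).totalDegree ≤ P.totalDegree - 1 := by
  classical
  rw [P.as_sum, map_sum]
  refine MvPolynomial.totalDegree_finsetSum_le fun m hm => ?_
  rw [← P.as_sum, MvPolynomial.pderiv_monomial]
  by_cases hi : m i = 0
  · simp [hi]
  refine (MvPolynomial.totalDegree_monomial_le _ _).trans ?_
  change (m - Finsupp.single i 1).sum (fun _ e => e) ≤ _
  have h1 := MvPolynomial.le_totalDegree hm
  have h2 : m = (m - Finsupp.single i 1) + Finsupp.single i 1 := by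
    refine (tsub_add_cancel_of_le ?_).symm
    rw [Finsupp.single_le_iff]; omega
  rw [h2, Finsupp.sum_add_index' (by simp) (by simp), Finsupp.sum_single_index rfl] at h1
  omega

theorem fderiv_mem_polySpace {k : ℕ} {p : Plane → ℝ} (hp : p ∈ polySpace k) (e : Plane) :
    (fun x => fderiv ℝ p x e) ∈ polySpace (k - 1) := by
  obtain ⟨P, hP, hp⟩ := mem_polySpace.1 hp
  obtain rfl : p = fun x => MvPolynomial.eval (fun i => x i) P := funext hp
  have : (fun x => fderiv ℝ (fun x : Plane => MvPolynomial.eval (fun i => x i) P) x e) =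
      ∑ i, e i • fun x : Plane => MvPolynomial.eval (fun i => x i) (MvPolynomial.pderiv i P) := by
    funext x
    simp [fderiv_eval_apply]
  rw [this]
  exact Submodule.sum_mem _ fun i _ => Submodule.smul_mem _ _ <|
    mem_polySpace.2 ⟨_, (totalDegree_pderiv_le P i).trans (Nat.sub_le_sub_right hP 1), fun _ => rfl⟩

/-- The restriction of a polynomial function to a line is a univariate polynomial. -/
theorem exists_polynomial_lineMap {k : ℕ} {p : Plane → ℝ} (hp : p ∈ polySpace k) (a b : Plane) :
    ∃ Q : Polynomial ℝ, Q.natDegree ≤ k ∧ ∀ t, p (AffineMap.lineMap a b t) = Q.eval t := by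
  obtain ⟨P, hP, hp⟩ := mem_polySpace.1 hp
  let g : Fin 2 → Polynomial ℝ := fun i => .C (b i - a i) * .X + .C (a i)
  have hg : ∀ i, (g i).natDegree ≤ 1 := fun i => Polynomial.natDegree_linear_le
  refine ⟨MvPolynomial.aeval g P, ?_, fun t => ?_⟩
  · rw [MvPolynomial.aeval_def, MvPolynomial.eval₂_eq']
    refine Polynomial.natDegree_sum_le_of_forall_le _ _ fun m hm => ?_
    have h1 := (MvPolynomial.le_totalDegree hm).trans hP
    rw [Finsupp.sum_fintype _ _ (by simp)] at h1
    refine (Polynomial.natDegree_C_mul_le _ _).trans ((Polynomial.natDegree_prod_le _ _).trans ?_)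
    refine (Finset.sum_le_sum fun i _ => ?_).trans h1
    exact Polynomial.natDegree_pow_le.trans ((Nat.mul_le_mul_left _ (hg i)).trans (by simp))
  · rw [hp, ← Polynomial.coe_evalRingHom, MvPolynomial.aeval_def, MvPolynomial.hom_eval₂]
    have h1 : (Polynomial.evalRingHom t).comp (algebraMap ℝ (Polynomial ℝ)) = RingHom.id ℝ := by
      ext; simp
    have h2 : (fun i => Polynomial.evalRingHom t (g i)) =
        fun i => (AffineMap.lineMap a b t : Plane) i := by
      funext i
      simp [g, AffineMap.lineMap_apply, mul_comm]
    rw [h1, h2]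
    rfl

/-- Every univariate polynomial is the restriction of a polynomial function to a given line. -/
theorem exists_mem_polySpace_lineMap {a b : Plane} (hab : a ≠ b) (Q : Polynomial ℝ) :
    ∃ q ∈ polySpace Q.natDegree, ∀ t, q (AffineMap.lineMap a b t) = Q.eval t := by
  have h0 : ‖b - a‖ ^ 2 ≠ 0 := by
    simpa [sub_eq_zero] using hab.symm
  let f : Plane →ᵃ[ℝ] ℝ :=
    ((‖b - a‖ ^ 2)⁻¹ • (innerSL ℝ (b - a) : Plane →ₗ[ℝ] ℝ)).toAffineMap.comp
      (AffineMap.id ℝ Plane - AffineMap.const ℝ Plane a)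
  have hf : ∀ t, f (AffineMap.lineMap a b t) = t := by
    intro t
    simp only [f, AffineMap.lineMap_apply, AffineMap.comp_apply, LinearMap.coe_toAffineMap,
      AffineMap.coe_sub, AffineMap.coe_id, AffineMap.coe_const, Pi.sub_apply,
      id_eq, Function.const_apply,
      LinearMap.smul_apply, vsub_eq_sub, vadd_eq_add, add_sub_cancel_right,
      ContinuousLinearMap.coe_coe, innerSL_apply_apply, inner_smul_right,
      real_inner_self_eq_norm_sq, smul_eq_mul]
    field_simp [pow_ne_zero_iff two_ne_zero |>.1 h0]
  refine ⟨fun x => Q.eval (f x), ?_, fun t => by simp [hf]⟩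
  have : (fun x => Q.eval (f x)) =
      ∑ i ∈ Finset.range (Q.natDegree + 1), Q.coeff i • fun x => f x ^ i := by
    funext x
    simp [Polynomial.eval_eq_sum_range]
  rw [this]
  refine Submodule.sum_mem _ fun i hi => Submodule.smul_mem _ _ ?_
  exact polySpace_mono (by simpa [Nat.lt_succ_iff] using hi)
    (pow_mem_polySpace (affine_mem_polySpace f) i)

/-- Polynomial functions that agree almost everywhere on a set with nonempty interior are equal. -/
theorem eq_of_ae_eq_of_mem_polySpace {j k : ℕ} {p q : Plane → ℝ} (hp : p ∈ polySpace j)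
    (hq : q ∈ polySpace k) {S : Set Plane} (hS : (interior S).Nonempty)
    (h : p =ᵐ[volume.restrict S] q) : p = q := by
  have han : ∀ {i : ℕ} {r : Plane → ℝ}, r ∈ polySpace i → AnalyticOnNhd ℝ r Set.univ := by
    intro i r hr
    rw [← contDiff_omega_iff_analyticOnNhd]
    exact contDiff_of_mem_polySpace hr
  have hEq : Set.EqOn p q (interior S) :=
    Measure.eqOn_open_of_ae_eq (ae_restrict_of_ae_restrict_of_subset interior_subset h)
      isOpen_interior (contDiff_of_mem_polySpace hp (n := 0)).continuous.continuousOn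
      (contDiff_of_mem_polySpace hq (n := 0)).continuous.continuousOn
  obtain ⟨z, hz⟩ := hS
  exact (han hp).eq_of_eventuallyEq (han hq)
    (hEq.eventuallyEq_of_mem (isOpen_interior.mem_nhds hz))

/-! ### Parity of orthogonal polynomials on the unit interval -/

theorem integral_reflect (f : ℝ → ℝ) :
    ∫ t in (0 : ℝ)..1, f (1 - t) = ∫ t in (0 : ℝ)..1, f t := by
  simp

/-- A polynomial of odd degree at most `m` that is orthogonal to all polynomials of degree less than
`m`, for a weight symmetric about `1/2`, is odd about `1/2`: the sum of the polynomial and its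
reflection has degree less than `m` and is orthogonal to itself. -/
theorem eval_one_sub_of_orthogonal {m j : ℕ} (hm : Odd m) {S : Polynomial ℝ}
    (hS : S.natDegree ≤ m)
    (h : ∀ Q : Polynomial ℝ, Q.natDegree ≤ m - 1 →
      ∫ t in (0 : ℝ)..1, (t * (1 - t)) ^ j * S.eval t * Q.eval t = 0) (t : ℝ) :
    S.eval (1 - t) = -S.eval t := by
  set ρ : Polynomial ℝ := 1 - .X with hρ
  have hρd : ρ.natDegree = 1 := by
    rw [hρ, ← Polynomial.C_1, Polynomial.natDegree_sub_eq_right_of_natDegree_lt] <;> simp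
  have hρl : ρ.leadingCoeff = -1 := by
    rw [Polynomial.leadingCoeff, hρd]; simp [hρ, Polynomial.coeff_one]
  have hρe : ∀ t, ρ.eval t = 1 - t := by simp [hρ]
  have hdeg : ∀ Q : Polynomial ℝ, (Q.comp ρ).natDegree ≤ Q.natDegree := fun Q =>
    Polynomial.natDegree_comp_le.trans (by rw [hρd, mul_one])
  set E := S + S.comp ρ with hE
  have hEc : E.coeff m = 0 := by
    rcases hS.lt_or_eq with hlt | heq
    · rw [hE, Polynomial.coeff_add, Polynomial.coeff_eq_zero_of_natDegree_lt hlt,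
        Polynomial.coeff_eq_zero_of_natDegree_lt ((hdeg S).trans_lt hlt), add_zero]
    · have := Polynomial.coeff_comp_degree_mul_degree (p := S) (q := ρ) (by simp [hρd])
      rw [hρd, mul_one, hρl, heq, hm.neg_one_pow, Polynomial.leadingCoeff, heq] at this
      rw [hE, Polynomial.coeff_add, this]
      ring
  have hEd : E.natDegree ≤ m - 1 := by
    have h1 : E.natDegree ≤ m := (Polynomial.natDegree_add_le _ _).trans
      (max_le hS ((hdeg S).trans hS))
    rcases h1.lt_or_eq with hlt | heq
    · omega
    · have : E = 0 := by
        rw [← Polynomial.leadingCoeff_eq_zero, Polynomial.leadingCoeff, heq, hEc]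
      simp [this]
  have hc : ∀ Q : Polynomial ℝ, Continuous fun t => Q.eval t := fun Q => Q.continuous
  have h1 := h E hEd
  have h2 : ∫ t in (0 : ℝ)..1, (t * (1 - t)) ^ j * S.eval (1 - t) * E.eval t = 0 := by
    refine Eq.trans ?_ ((integral_reflect _).trans (h (E.comp ρ) ((hdeg E).trans hEd)))
    refine intervalIntegral.integral_congr fun (t : ℝ) _ => ?_
    simp only [Polynomial.eval_comp, hρe, sub_sub_cancel, mul_comm t]
  have h3 : ∫ t in (0 : ℝ)..1, (t * (1 - t)) ^ j * E.eval t ^ 2 = 0 := by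
    refine Eq.trans ?_ ((congrArg₂ (· + ·) h1 h2).trans (add_zero 0))
    rw [← intervalIntegral.integral_add]
    · refine intervalIntegral.integral_congr fun t _ => ?_
      simp only [hE, Polynomial.eval_add, Polynomial.eval_comp, hρe]
      ring
    · exact (by fun_prop : Continuous _).intervalIntegrable _ _
    · have := (hc S).comp (continuous_const.sub continuous_id : Continuous fun t : ℝ => 1 - t)
      refine Continuous.intervalIntegrable ?_ _ _
      exact ((by fun_prop : Continuous fun t : ℝ => (t * (1 - t)) ^ j).mul this).mul (hc E)
  have h4 : ∀ t ∈ Set.Ioo (0 : ℝ) 1, E.eval t = 0 := by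
    by_contra! hcon
    obtain ⟨t, ht, hne⟩ := hcon
    refine (intervalIntegral.integral_pos (a := 0) (b := 1)
      (f := fun t => (t * (1 - t)) ^ j * E.eval t ^ 2) one_pos
      (by fun_prop) (fun x hx => ?_) ⟨t, Set.Ioo_subset_Icc_self ht, ?_⟩).ne' h3
    · have : 0 ≤ 1 - x := by linarith [hx.2]
      have := hx.1.le
      positivity
    · have : 0 < 1 - t := by linarith [ht.2]
      have := ht.1
      positivity
  have h5 : E = 0 := Polynomial.eq_zero_of_infinite_isRoot _
    ((Set.Ioo_infinite one_pos).mono fun t ht => h4 t ht)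
  have h6 : E.eval t = 0 := by rw [h5, Polynomial.eval_zero]
  rw [hE, Polynomial.eval_add, Polynomial.eval_comp, hρe] at h6
  linarith

/-- A polynomial of the form `R + (t (1 - t))² S` with an orthogonal polynomial `S` of odd degree
`ℓ - 3` that vanishes at both endpoints and has vanishing moments up to order `ℓ - 3` is odd about
`1/2`. Hence its moment of the even order `ℓ - 2` vanishes as well. -/
theorem integral_mul_eq_zero_of_moments {ℓ : ℕ} (hℓ : 4 ≤ ℓ) (heven : Even ℓ)
    {R S : Polynomial ℝ} (hR : R.natDegree ≤ ℓ - 1) (hS : S.natDegree ≤ ℓ - 3)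
    (hSo : ∀ Q : Polynomial ℝ, Q.natDegree ≤ ℓ - 4 →
      ∫ t in (0 : ℝ)..1, (t * (1 - t)) ^ 2 * S.eval t * Q.eval t = 0)
    {J : ℝ → ℝ} (hJ : ∀ t, J t = R.eval t + (t * (1 - t)) ^ 2 * S.eval t)
    (hJ0 : J 0 = 0) (hJ1 : J 1 = 0)
    (hJo : ∀ Q : Polynomial ℝ, Q.natDegree ≤ ℓ - 3 → ∫ t in (0 : ℝ)..1, J t * Q.eval t = 0)
    (Q : Polynomial ℝ) (hQ : Q.natDegree ≤ ℓ - 2) :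
    ∫ t in (0 : ℝ)..1, J t * Q.eval t = 0 := by
  have hodd : Odd (ℓ - 3) := by
    obtain ⟨k, hk⟩ := heven
    exact ⟨k - 2, by omega⟩
  have hR0 : R.eval 0 = 0 := by simpa [hJ] using hJ0
  have hR1 : R.eval 1 = 0 := by simpa [hJ] using hJ1
  obtain ⟨R', hR'⟩ : ∃ R', R = .X * (1 - .X) * R' := by
    obtain ⟨A, hA⟩ := Polynomial.dvd_iff_isRoot.2 hR1
    obtain ⟨B, hB⟩ : (.X - .C 0 : Polynomial ℝ) ∣ A := by
      rw [Polynomial.dvd_iff_isRoot]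
      simpa [hA] using hR0
    refine ⟨-B, ?_⟩
    rw [hA, hB]
    simp only [map_one, map_zero]
    ring
  have hR'd : R'.natDegree ≤ ℓ - 3 := by
    by_cases h0 : R' = 0
    · simp [h0]
    have h1 : (1 - .X : Polynomial ℝ).natDegree = 1 := by
      rw [← Polynomial.C_1, Polynomial.natDegree_sub_eq_right_of_natDegree_lt] <;> simp
    have h2 : (1 - .X : Polynomial ℝ) ≠ 0 := by
      intro h; rw [h] at h1; simp at h1
    rw [hR', Polynomial.natDegree_mul (mul_ne_zero Polynomial.X_ne_zero h2) h0,
      Polynomial.natDegree_mul Polynomial.X_ne_zero h2, Polynomial.natDegree_X, h1] at hR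
    omega
  have hJc : Continuous J := by
    rw [funext hJ]; fun_prop
  have hR'e : ∀ t, R.eval t = t * (1 - t) * R'.eval t := by simp [hR']
  have hR'o : ∀ Q : Polynomial ℝ, Q.natDegree ≤ ℓ - 3 - 1 →
      ∫ t in (0 : ℝ)..1, (t * (1 - t)) ^ 1 * R'.eval t * Q.eval t = 0 := by
    intro Q hQ
    have h1 := hJo Q (by omega)
    have h2 := hSo Q (by omega)
    refine Eq.trans ?_ ((congrArg₂ (· - ·) h1 h2).trans (sub_zero 0))
    rw [← intervalIntegral.integral_sub]
    · refine intervalIntegral.integral_congr fun t _ => ?_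
      simp only [hJ, hR'e]
      ring
    · exact (by fun_prop : Continuous _).intervalIntegrable _ _
    · exact (by fun_prop : Continuous _).intervalIntegrable _ _
  have hR'r := eval_one_sub_of_orthogonal hodd hR'd hR'o
  have hSr := eval_one_sub_of_orthogonal (j := 2) hodd hS fun Q hQ => hSo Q (by omega)
  have hJr : ∀ t, J (1 - t) = -J t := by
    intro t
    rw [hJ, hJ, hR'e, hR'e, hR'r, hSr]
    ring
  -- Subtracting a multiple of the even polynomial `(t - 1/2) ^ (ℓ - 2)` lowers the degree of `Q`.
  set c := Q.coeff (ℓ - 2)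
  set W : Polynomial ℝ := (.X - .C (1 / 2)) ^ (ℓ - 2) with hW
  have hWd : W.natDegree = ℓ - 2 := by simp [hW, Polynomial.natDegree_pow]
  have hWl : W.coeff (ℓ - 2) = 1 := by
    have : W.Monic := (Polynomial.monic_X_sub_C _).pow _
    rw [← hWd]; exact this
  have hd : (Q - .C c * W).natDegree ≤ ℓ - 3 := by
    have h1 : (Q - .C c * W).natDegree ≤ ℓ - 2 :=
      (Polynomial.natDegree_sub_le _ _).trans
        (max_le hQ ((Polynomial.natDegree_C_mul_le _ _).trans hWd.le))
    rcases h1.lt_or_eq with hlt | heq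
    · omega
    · have : Q - .C c * W = 0 := by
        rw [← Polynomial.leadingCoeff_eq_zero, Polynomial.leadingCoeff, heq, Polynomial.coeff_sub,
          Polynomial.coeff_C_mul, hWl, mul_one, sub_self]
      simp [this]
  have hWi : ∫ t in (0 : ℝ)..1, J t * W.eval t = 0 := by
    have h1 := integral_reflect fun t => J t * W.eval t
    have h2 : ∀ t, J (1 - t) * W.eval (1 - t) = -(J t * W.eval t) := by
      intro t
      have he : Even (ℓ - 2) := by
        obtain ⟨k, hk⟩ := heven
        exact ⟨k - 1, by omega⟩
      have h3 : W.eval (1 - t) = W.eval t := by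
        simp only [hW, Polynomial.eval_pow, Polynomial.eval_sub, Polynomial.eval_X,
          Polynomial.eval_C]
        rw [← he.neg_pow]
        congr 1; ring
      rw [hJr, h3, neg_mul]
    simp only [h2, intervalIntegral.integral_neg] at h1
    linarith
  have h1 := hJo _ hd
  have h2 : ∀ t, J t * Q.eval t = J t * (Q - .C c * W).eval t + c * (J t * W.eval t) := by
    intro t
    simp only [Polynomial.eval_sub, Polynomial.eval_mul, Polynomial.eval_C]
    ring
  simp only [h2]
  rw [intervalIntegral.integral_add, intervalIntegral.integral_const_mul, h1, hWi]
  · ring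
  · exact (by fun_prop : Continuous _).intervalIntegrable _ _
  · exact (by fun_prop : Continuous _).intervalIntegrable _ _

/-! ### Shape functions on the edges of a triangle -/

theorem edgeIntegral_symm (a b : Plane) (f : Plane → ℝ) :
    edgeIntegral a b f = edgeIntegral b a f := by
  rw [edgeIntegral, edgeIntegral, dist_comm, ← integral_reflect]
  simp only [AffineMap.lineMap_apply_one_sub]

/-- The properties of the shape functions on the edge with endpoints `a` and `b`: the function `f`
is a polynomial of degree at most `ℓ` on the edge, and any directional derivative on the edge is the
sum of a polynomial of degree at most `ℓ - 1` and a multiple of the squared edge bubble by an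
orthogonal polynomial of degree at most `ℓ - 3`. -/
structure HasEdgeForm (ℓ : ℕ) (a b : Plane) (f : Plane → ℝ) : Prop where
  exists_mem : ∃ k, f ∈ polySpace k
  trace : ∃ G : Polynomial ℝ, G.natDegree ≤ ℓ ∧ ∀ t, f (AffineMap.lineMap a b t) = G.eval t
  deriv : ∀ n : Plane, ∃ R S : Polynomial ℝ, R.natDegree ≤ ℓ - 1 ∧ S.natDegree ≤ ℓ - 3 ∧
    (∀ Q : Polynomial ℝ, Q.natDegree ≤ ℓ - 4 →
      ∫ t in (0 : ℝ)..1, (t * (1 - t)) ^ 2 * S.eval t * Q.eval t = 0) ∧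
    ∀ t, fderiv ℝ f (AffineMap.lineMap a b t) n = R.eval t + (t * (1 - t)) ^ 2 * S.eval t

namespace HasEdgeForm

variable {ℓ : ℕ} {a b : Plane} {f g : Plane → ℝ}

theorem contDiff (hf : HasEdgeForm ℓ a b f) {n : WithTop ℕ∞} : ContDiff ℝ n f :=
  let ⟨_, hk⟩ := hf.exists_mem
  contDiff_of_mem_polySpace hk

theorem of_mem_polySpace (hf : f ∈ polySpace ℓ) (a b : Plane) : HasEdgeForm ℓ a b f where
  exists_mem := ⟨ℓ, hf⟩
  trace := exists_polynomial_lineMap hf a b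
  deriv n := by
    obtain ⟨R, hR, h⟩ := exists_polynomial_lineMap (fderiv_mem_polySpace hf n) a b
    exact ⟨R, 0, hR, by simp, by simp, by simpa using h⟩

theorem add (hf : HasEdgeForm ℓ a b f) (hg : HasEdgeForm ℓ a b g) :
    HasEdgeForm ℓ a b (f + g) where
  exists_mem := by
    obtain ⟨j, hj⟩ := hf.exists_mem
    obtain ⟨k, hk⟩ := hg.exists_mem
    exact ⟨max j k, Submodule.add_mem _ (polySpace_mono (le_max_left j k) hj)
      (polySpace_mono (le_max_right j k) hk)⟩
  trace := by
    obtain ⟨F, hF, hF'⟩ := hf.trace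
    obtain ⟨G, hG, hG'⟩ := hg.trace
    exact ⟨F + G, (Polynomial.natDegree_add_le _ _).trans (max_le hF hG),
      fun t => by simp [hF', hG']⟩
  deriv n := by
    obtain ⟨R, S, hR, hS, ho, h⟩ := hf.deriv n
    obtain ⟨R', S', hR', hS', ho', h'⟩ := hg.deriv n
    refine ⟨R + R', S + S', (Polynomial.natDegree_add_le _ _).trans (max_le hR hR'),
      (Polynomial.natDegree_add_le _ _).trans (max_le hS hS'), fun Q hQ => ?_, fun t => ?_⟩
    · simp only [Polynomial.eval_add, mul_add, add_mul]
      rw [intervalIntegral.integral_add, ho Q hQ, ho' Q hQ, add_zero]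
      · exact (by fun_prop : Continuous _).intervalIntegrable _ _
      · exact (by fun_prop : Continuous _).intervalIntegrable _ _
    · rw [fderiv_add (hf.contDiff.differentiable one_ne_zero _)
        (hg.contDiff.differentiable one_ne_zero _), add_apply, h, h']
      simp only [Polynomial.eval_add]
      ring

theorem smul (c : ℝ) (hf : HasEdgeForm ℓ a b f) : HasEdgeForm ℓ a b (c • f) where
  exists_mem := by
    obtain ⟨j, hj⟩ := hf.exists_mem
    exact ⟨j, Submodule.smul_mem _ _ hj⟩
  trace := by
    obtain ⟨F, hF, hF'⟩ := hf.trace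
    exact ⟨c • F, (Polynomial.natDegree_smul_le _ _).trans hF, fun t => by simp [hF']⟩
  deriv n := by
    obtain ⟨R, S, hR, hS, ho, h⟩ := hf.deriv n
    refine ⟨c • R, c • S, (Polynomial.natDegree_smul_le _ _).trans hR,
      (Polynomial.natDegree_smul_le _ _).trans hS, fun Q hQ => ?_, fun t => ?_⟩
    · have h1 : ∀ t : ℝ, (t * (1 - t)) ^ 2 * (c • S).eval t * Q.eval t =
          c * ((t * (1 - t)) ^ 2 * S.eval t * Q.eval t) := by
        intro t
        simp only [Polynomial.eval_smul, smul_eq_mul]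
        ring
      simp only [h1, intervalIntegral.integral_const_mul, ho Q hQ, mul_zero]
    · rw [fderiv_const_smul (hf.contDiff.differentiable one_ne_zero _), smul_apply, h]
      simp only [Polynomial.eval_smul, smul_eq_mul]
      ring

end HasEdgeForm

theorem coord_mem_polySpace (T : AffineBasis (Fin 3) ℝ Plane) (i : Fin 3) :
    (fun x => T.coord i x) ∈ polySpace 1 := affine_mem_polySpace (T.coord i)

theorem volumeBubble_eq (T : AffineBasis (Fin 3) ℝ Plane) (i : Fin 3) (x : Plane) :
    volumeBubble T x = T.coord i x * edgeBubble T i x := by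
  rw [volumeBubble, edgeBubble, Fin.prod_univ_three]
  fin_cases i
  · change _ = T.coord 0 x * (T.coord 2 x * T.coord 1 x); ring
  · change _ = T.coord 1 x * (T.coord 0 x * T.coord 2 x); ring
  · change _ = T.coord 2 x * (T.coord 1 x * T.coord 0 x); ring

theorem coord_lineMap (T : AffineBasis (Fin 3) ℝ Plane) (i j k : Fin 3) (t : ℝ) :
    T.coord i (AffineMap.lineMap (T j) (T k) t) =
      (1 - t) * (if i = j then 1 else 0) + t * (if i = k then 1 else 0) := by
  rw [AffineMap.apply_lineMap, AffineBasis.coord_apply, AffineBasis.coord_apply,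
    AffineMap.lineMap_apply_module]
  simp

/-- The bubble function of the edge `F_i` has the factor `λ_i b_{F_i}²`. So its gradient is
`b_{F_i}² ψ_i ∇λ_i` on `F_i` and vanishes on the other edges. -/
theorem HasEdgeForm.of_isBubble {ℓ : ℕ} {s : Finset Plane} {f : Plane → ℝ}
    (hf : IsBubble ℓ s f) {a b : Plane} (ha : a ∈ s) (hb : b ∈ s) (hab : a ≠ b) :
    HasEdgeForm ℓ a b f := by
  obtain ⟨T, hT, -, i, ψ, ⟨⟨c, hc⟩, hψo⟩, hf⟩ := hf
  obtain ⟨j, rfl⟩ : a ∈ Set.range T := by rw [hT]; exact ha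
  obtain ⟨k, rfl⟩ : b ∈ Set.range T := by rw [hT]; exact hb
  have hjk : j ≠ k := fun h => hab (congrArg T h)
  have hψ : ψ ∈ polySpace (ℓ - 3) := by
    have : ψ = (fun x => T.coord (i + 1) x ^ (ℓ - 3)) +
        ∑ k ∈ Finset.range (ℓ - 3), c k • fun x => T.coord (i + 1) x ^ k := by
      funext x
      simp [hc]
    rw [this]
    refine Submodule.add_mem _ (pow_mem_polySpace (coord_mem_polySpace T _) _)
      (Submodule.sum_mem _ fun m hm => Submodule.smul_mem _ _ ?_)
    exact polySpace_mono (Finset.mem_range.1 hm).le (pow_mem_polySpace (coord_mem_polySpace T _) _)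
  have hb : edgeBubble T i ∈ polySpace (1 + 1) :=
    mul_mem_polySpace (coord_mem_polySpace T _) (coord_mem_polySpace T _)
  have hd : ∀ {m : ℕ} {p : Plane → ℝ}, p ∈ polySpace m → Differentiable ℝ p := fun hp =>
    (contDiff_of_mem_polySpace hp).differentiable one_ne_zero
  have hfe : f = fun x => T.coord i x * (edgeBubble T i x * edgeBubble T i x * ψ x) := by
    funext x
    rw [hf, volumeBubble_eq T i]
    ring
  have hmem : f ∈ polySpace (1 + ((1 + 1) + (1 + 1) + (ℓ - 3))) := by
    rw [hfe]
    exact mul_mem_polySpace (coord_mem_polySpace T _)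
      (mul_mem_polySpace (mul_mem_polySpace hb hb) hψ)
  have hfd : ∀ x n, fderiv ℝ f x n = fderiv ℝ (T.coord i) x n * (edgeBubble T i x ^ 2 * ψ x) +
      T.coord i x * (edgeBubble T i x *
        (2 * fderiv ℝ (edgeBubble T i) x n * ψ x + edgeBubble T i x * fderiv ℝ ψ x n)) := by
    intro x n
    rw [hfe, fderiv_fun_mul (hd (coord_mem_polySpace T i) x)
      (hd (mul_mem_polySpace (mul_mem_polySpace hb hb) hψ) x),
      fderiv_fun_mul (hd (mul_mem_polySpace hb hb) x) (hd hψ x), fderiv_fun_mul (hd hb x) (hd hb x)]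
    simp only [add_apply, smul_apply, smul_eq_mul]
    ring
  have hcase : (i ≠ j ∧ i ≠ k ∧ ((j = i - 1 ∧ k = i + 1) ∨ (j = i + 1 ∧ k = i - 1))) ∨
      (i - 1 ≠ j ∧ i - 1 ≠ k) ∨ (i + 1 ≠ j ∧ i + 1 ≠ k) := by
    clear * - hjk; revert i j k; decide
  -- The bubble vanishes on all edges.
  have htr : ∀ t : ℝ, T.coord i (AffineMap.lineMap (T j) (T k) t) *
      edgeBubble T i (AffineMap.lineMap (T j) (T k) t) = 0 := by
    intro t
    rw [edgeBubble, coord_lineMap, coord_lineMap, coord_lineMap]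
    rcases hcase with ⟨h1, h2, -⟩ | ⟨h1, h2⟩ | ⟨h1, h2⟩ <;> simp [h1, h2]
  refine ⟨⟨_, hmem⟩, ⟨0, by simp, fun t => ?_⟩, fun n => ?_⟩
  · rw [hfe, Polynomial.eval_zero]
    linear_combination (edgeBubble T i (AffineMap.lineMap (T j) (T k) t) *
      ψ (AffineMap.lineMap (T j) (T k) t)) * htr t
  by_cases hi : i ≠ j ∧ i ≠ k
  · obtain ⟨h1, h2, hor⟩ : i ≠ j ∧ i ≠ k ∧ ((j = i - 1 ∧ k = i + 1) ∨ (j = i + 1 ∧ k = i - 1)) := by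
      clear * - hi hjk; revert i j k; decide
    obtain ⟨S, hS, hS'⟩ := exists_polynomial_lineMap hψ (T j) (T k)
    have hbt : ∀ t : ℝ, edgeBubble T i (AffineMap.lineMap (T j) (T k) t) = t * (1 - t) := by
      intro t
      have hne : ∀ i : Fin 3, i - 1 ≠ i + 1 := by decide
      rw [edgeBubble, coord_lineMap, coord_lineMap]
      rcases hor with ⟨rfl, rfl⟩ | ⟨rfl, rfl⟩ <;> simp [hne, (hne _).symm, mul_comm]
    have hdc : ∀ x, fderiv ℝ (T.coord i) x n = fderiv ℝ (T.coord i) 0 n := by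
      intro x
      have := fderiv_mem_polySpace (coord_mem_polySpace T i) n
      obtain ⟨P, hP, hP'⟩ := mem_polySpace.1 this
      rw [Nat.sub_self, Nat.le_zero, MvPolynomial.totalDegree_eq_zero_iff_eq_C] at hP
      have h1 := hP' x
      have h2 := hP' 0
      rw [hP, MvPolynomial.eval_C] at h1 h2
      exact h1.trans h2.symm
    have hdist : dist (T j) (T k) ≠ 0 := dist_ne_zero.2 hab
    refine ⟨0, fderiv ℝ (T.coord i) 0 n • S, by simp,
      (Polynomial.natDegree_smul_le _ _).trans hS, fun Q hQ => ?_, fun t => ?_⟩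
    · obtain ⟨q, hq, hq'⟩ := exists_mem_polySpace_lineMap hab Q
      have h3 := hψo q (polySpace_mono hQ hq)
      have h4 : edgeIntegral (T j) (T k) (fun x => edgeBubble T i x ^ 2 * ψ x * q x) = 0 := by
        rcases hor with ⟨rfl, rfl⟩ | ⟨rfl, rfl⟩
        · exact h3
        · rwa [edgeIntegral_symm]
      rw [edgeIntegral] at h4
      have h5 := (mul_eq_zero.1 h4).resolve_left hdist
      simp only [hbt, hS', hq'] at h5
      have h6 : ∀ t : ℝ, (t * (1 - t)) ^ 2 * (fderiv ℝ (T.coord i) 0 n • S).eval t * Q.eval t =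
          fderiv ℝ (T.coord i) 0 n * ((t * (1 - t)) ^ 2 * S.eval t * Q.eval t) := by
        intro t
        simp only [Polynomial.eval_smul, smul_eq_mul]
        ring
      simp only [h6, intervalIntegral.integral_const_mul, h5, mul_zero]
    · rw [hfd, coord_lineMap, hbt, hS', hdc]
      simp only [h1, h2, if_false, Polynomial.eval_smul, smul_eq_mul, Polynomial.eval_zero]
      ring
  · have hb0 : ∀ t : ℝ, edgeBubble T i (AffineMap.lineMap (T j) (T k) t) = 0 := by
      intro t
      rw [edgeBubble, coord_lineMap, coord_lineMap]
      rcases hcase with ⟨h1, h2, -⟩ | ⟨h1, h2⟩ | ⟨h1, h2⟩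
      · exact absurd ⟨h1, h2⟩ hi
      · simp [h1, h2]
      · simp [h1, h2]
    exact ⟨0, 0, by simp, by simp, by simp, fun t => by rw [hfd, hb0]; simp⟩

theorem HasEdgeForm.of_mem_shapeSpace {ℓ : ℕ} {s : Finset Plane} {f : Plane → ℝ}
    (hf : f ∈ shapeSpace ℓ s) {a b : Plane} (ha : a ∈ s) (hb : b ∈ s) (hab : a ≠ b) :
    HasEdgeForm ℓ a b f := by
  obtain ⟨p, hp, q, hq, rfl⟩ := Submodule.mem_sup.1 hf
  refine (of_mem_polySpace hp a b).add ?_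
  clear hf
  induction hq using Submodule.span_induction with
  | mem x hx => exact of_isBubble hx ha hb hab
  | zero => exact of_mem_polySpace (Submodule.zero_mem _) a b
  | add x y _ _ hx hy => exact hx.add hy
  | smul c x _ hx => exact hx.smul c

/-! ### The pieces of a finite element function -/

theorem piece_eq {k : ℕ} {s : Finset Plane} {v p : Plane → ℝ} (hp : p ∈ polySpace k)
    (hs : (interior (convexHull ℝ (s : Set Plane))).Nonempty) (h : AgreesOn s v p) :
    piece v s = p := by
  have hex : ∃ p : Plane → ℝ, (∃ k, p ∈ polySpace k) ∧ AgreesOn s v p := ⟨p, ⟨k, hp⟩, h⟩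
  rw [piece, dif_pos hex]
  obtain ⟨⟨j, hj⟩, h'⟩ := hex.choose_spec
  exact eq_of_ae_eq_of_mem_polySpace hj hp hs (h'.symm.trans h)

namespace Triangulation

variable {Ω : Set Plane} {𝒯 : Triangulation Ω}

theorem mem_faces {s : Finset Plane} (hs : s ∈ 𝒯.elements) : s ∈ 𝒯.faces := by
  simpa using (Finset.mem_filter.1 hs).1

/-- Every enumeration of the vertices of an element is an affine basis of the plane. -/
theorem exists_affineBasis {s : Finset Plane} (hs : s ∈ 𝒯.elements) {a b : Plane} (ha : a ∈ s)
    (hb : b ∈ s) (hab : a ≠ b) :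
    ∃ T : AffineBasis (Fin 3) ℝ Plane, T 0 = a ∧ T 1 = b ∧ (s : Set Plane) = Set.range T := by
  have hcard : s.card = 3 := (Finset.mem_filter.1 hs).2
  obtain ⟨c, hc, hcab⟩ : ∃ c ∈ s, c ∉ ({a, b} : Finset Plane) := by
    refine Finset.exists_mem_notMem_of_card_lt_card ?_
    rw [hcard]
    exact (Finset.card_le_two).trans_lt (by norm_num)
  simp only [Finset.mem_insert, Finset.mem_singleton, not_or] at hcab
  let e : Fin 3 → s := ![⟨a, ha⟩, ⟨b, hb⟩, ⟨c, hc⟩]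
  have he : Function.Injective e := by
    intro i j hij
    fin_cases i <;> fin_cases j <;> simp_all [e, eq_comm]
  have hind : AffineIndependent ℝ (((↑) : s → Plane) ∘ e) :=
    (𝒯.indep (mem_faces hs)).comp_embedding ⟨e, he⟩
  have htop : affineSpan ℝ (Set.range (((↑) : s → Plane) ∘ e)) = ⊤ := by
    rw [hind.affineSpan_eq_top_iff_card_eq_finrank_add_one]
    simp
  refine ⟨⟨((↑) : s → Plane) ∘ e, hind, htop⟩, rfl, rfl, ?_⟩
  have hsurj : Function.Surjective e :=
    ((Fintype.bijective_iff_injective_and_card e).2 ⟨he, by simp [hcard]⟩).surjective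
  change _ = Set.range (((↑) : s → Plane) ∘ e)
  rw [hsurj.range_comp]
  simp

theorem exists_affineBasis_range {s : Finset Plane} (hs : s ∈ 𝒯.elements) :
    ∃ T : AffineBasis (Fin 3) ℝ Plane, (s : Set Plane) = Set.range T := by
  have hcard : s.card = 3 := (Finset.mem_filter.1 hs).2
  obtain ⟨a, ha, b, hb, hab⟩ := Finset.one_lt_card.1 (by omega : 1 < s.card)
  obtain ⟨T, -, -, hT⟩ := exists_affineBasis hs ha hb hab
  exact ⟨T, hT⟩

theorem interior_nonempty {s : Finset Plane} (hs : s ∈ 𝒯.elements) :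
    (interior (convexHull ℝ (s : Set Plane))).Nonempty := by
  obtain ⟨T, hT⟩ := exists_affineBasis_range hs
  rw [hT]
  exact ⟨_, T.centroid_mem_interior_convexHull⟩

theorem piece_spec {ℓ : ℕ} {v : Plane → ℝ} (hv : v ∈ 𝒯.feSpace ℓ) {s : Finset Plane}
    (hs : s ∈ 𝒯.elements) : piece v s ∈ shapeSpace ℓ s ∧ AgreesOn s v (piece v s) := by
  obtain ⟨p, hp, h⟩ := hv.2.1 s hs
  obtain ⟨T, hT⟩ := exists_affineBasis_range hs
  have h0 : T 0 ∈ s := by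
    rw [← Finset.mem_coe, hT]; exact ⟨0, rfl⟩
  have h1 : T 1 ∈ s := by
    rw [← Finset.mem_coe, hT]; exact ⟨1, rfl⟩
  obtain ⟨k, hk⟩ := (HasEdgeForm.of_mem_shapeSpace hp h0 h1
    (T.ind.injective.ne (by decide))).exists_mem
  rw [piece_eq hk (interior_nonempty hs) h]
  exact ⟨hp, h⟩

theorem hasEdgeForm_piece {ℓ : ℕ} {v : Plane → ℝ} (hv : v ∈ 𝒯.feSpace ℓ) {s : Finset Plane}
    (hs : s ∈ 𝒯.elements) {a b : Plane} (ha : a ∈ s) (hb : b ∈ s) (hab : a ≠ b) :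
    HasEdgeForm ℓ a b (piece v s) :=
  HasEdgeForm.of_mem_shapeSpace (piece_spec hv hs).1 ha hb hab

theorem exists_piece_mem_polySpace {ℓ : ℕ} {v : Plane → ℝ} (hv : v ∈ 𝒯.feSpace ℓ)
    {s : Finset Plane} (hs : s ∈ 𝒯.elements) : ∃ k, piece v s ∈ polySpace k := by
  have hcard : s.card = 3 := (Finset.mem_filter.1 hs).2
  obtain ⟨a, ha, b, hb, hab⟩ := Finset.one_lt_card.1 (by omega : 1 < s.card)
  exact (hasEdgeForm_piece hv hs ha hb hab).exists_mem

theorem contDiff_piece {ℓ : ℕ} {v : Plane → ℝ} (hv : v ∈ 𝒯.feSpace ℓ)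
    {s : Finset Plane} (hs : s ∈ 𝒯.elements) {n : WithTop ℕ∞} : ContDiff ℝ n (piece v s) :=
  let ⟨_, hk⟩ := exists_piece_mem_polySpace hv hs
  contDiff_of_mem_polySpace hk

/-- The normal derivative jump of a finite element function vanishes at the endpoints of an edge. -/
theorem normalJump_vertex {ℓ : ℕ} {v : Plane → ℝ} (hv : v ∈ 𝒯.feSpace ℓ) {s₁ s₂ : Finset Plane}
    (h₁ : s₁ ∈ 𝒯.elements) (h₂ : s₂ ∈ 𝒯.elements) {z : Plane} (hz₁ : z ∈ s₁) (hz₂ : z ∈ s₂)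
    (n : Plane) : normalJump v s₁ s₂ n z = 0 := by
  have h := hv.2.2.1 s₁ h₁ s₂ h₂ z hz₁ hz₂
  have h' : fderiv ℝ (piece v s₁) z = fderiv ℝ (piece v s₂) z :=
    (InnerProductSpace.toDual ℝ Plane).symm.injective h
  rw [normalJump, h', sub_self]

theorem integral_normalJump_mul_eval {ℓ : ℕ} (hℓ : 4 ≤ ℓ) (heven : Even ℓ) {v : Plane → ℝ}
    (hv : v ∈ 𝒯.feSpace ℓ) {a b : Plane} {s₁ s₂ : Finset Plane}
    (he : 𝒯.IsInteriorEdge a b s₁ s₂) {n : Plane} (hn : IsOutwardNormal s₁ a b n)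
    (Q : Polynomial ℝ) (hQ : Q.natDegree ≤ ℓ - 2) :
    ∫ t in (0 : ℝ)..1, normalJump v s₁ s₂ n (AffineMap.lineMap a b t) * Q.eval t = 0 := by
  obtain ⟨R₁, S₁, hR₁, hS₁, ho₁, hd₁⟩ :=
    (hasEdgeForm_piece hv he.mem₁ he.left_mem₁ he.right_mem₁ he.ne).deriv n
  obtain ⟨R₂, S₂, hR₂, hS₂, ho₂, hd₂⟩ :=
    (hasEdgeForm_piece hv he.mem₂ he.left_mem₂ he.right_mem₂ he.ne).deriv n
  refine integral_mul_eq_zero_of_moments hℓ heven (R := R₁ - R₂) (S := S₁ - S₂)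
    ((Polynomial.natDegree_sub_le _ _).trans (max_le hR₁ hR₂))
    ((Polynomial.natDegree_sub_le _ _).trans (max_le hS₁ hS₂)) (fun q hq => ?_) (fun t => ?_)
    ?_ ?_ (fun q hq => ?_) Q hQ
  · refine Eq.trans ?_ ((congrArg₂ (· - ·) (ho₁ q hq) (ho₂ q hq)).trans (sub_zero 0))
    rw [← intervalIntegral.integral_sub]
    · simp only [Polynomial.eval_sub, mul_sub, sub_mul]
    · exact (by fun_prop : Continuous _).intervalIntegrable _ _
    · exact (by fun_prop : Continuous _).intervalIntegrable _ _
  · rw [normalJump, hd₁, hd₂]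
    simp only [Polynomial.eval_sub]
    ring
  · rw [AffineMap.lineMap_apply_zero]
    exact normalJump_vertex hv he.mem₁ he.mem₂ he.left_mem₁ he.left_mem₂ n
  · rw [AffineMap.lineMap_apply_one]
    exact normalJump_vertex hv he.mem₁ he.mem₂ he.right_mem₁ he.right_mem₂ n
  · obtain ⟨p, hp, hp'⟩ := exists_mem_polySpace_lineMap he.ne q
    have h := hv.2.2.2 a b s₁ s₂ he n hn p (polySpace_mono hq hp)
    rw [edgeIntegral] at h
    simpa only [hp'] using (mul_eq_zero.1 h).resolve_left (dist_ne_zero.2 he.ne)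

theorem normalMomentContinuity_of_mem_feSpace {ℓ : ℕ} (hℓ : 4 ≤ ℓ) (heven : Even ℓ)
    {v : Plane → ℝ} (hv : v ∈ 𝒯.feSpace ℓ) : 𝒯.NormalMomentContinuity (ℓ - 2) v := by
  intro a b s₁ s₂ he n hn q hq
  obtain ⟨Q, hQ, hQ'⟩ := exists_polynomial_lineMap hq a b
  rw [edgeIntegral]
  simp only [hQ', integral_normalJump_mul_eval hℓ heven hv he hn Q hQ, mul_zero]

end Triangulation

/-! ### Affine parametrizations of the plane -/

/-- The determinant of two vectors of the plane. -/
def cross (u w : Plane) : ℝ := u 0 * w 1 - u 1 * w 0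

/-- The affine coordinates on the plane with origin `a` and coordinate vectors `u`, `w`. -/
def affineParam (a u w : Plane) (p : ℝ × ℝ) : Plane := a + p.1 • u + p.2 • w

theorem continuous_affineParam (a u w : Plane) : Continuous (affineParam a u w) := by
  unfold affineParam; fun_prop

theorem affineParam_injective {a u w : Plane} (h : cross u w ≠ 0) :
    Function.Injective (affineParam a u w) := by
  intro p q hpq
  have h0 : p.1 * u 0 + p.2 * w 0 = q.1 * u 0 + q.2 * w 0 := by
    simpa [affineParam, add_assoc] using congrArg (fun x : Plane => x 0) hpq
  have h1 : p.1 * u 1 + p.2 * w 1 = q.1 * u 1 + q.2 * w 1 := by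
    simpa [affineParam, add_assoc] using congrArg (fun x : Plane => x 1) hpq
  rw [cross] at h
  refine Prod.ext (mul_right_cancel₀ h ?_) (mul_right_cancel₀ h ?_)
  · linear_combination w 1 * h0 - w 0 * h1
  · linear_combination u 0 * h1 - u 1 * h0

theorem measurableEmbedding_affineParam {a u w : Plane} (h : cross u w ≠ 0) :
    MeasurableEmbedding (affineParam a u w) :=
  (continuous_affineParam a u w).measurableEmbedding (affineParam_injective h)

theorem map_affineParam_volume {a u w : Plane} (h : cross u w ≠ 0) :
    Measure.map (affineParam a u w) volume = ENNReal.ofReal |cross u w|⁻¹ • volume := by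
  let M : ℝ × ℝ →ₗ[ℝ] ℝ × ℝ :=
    Matrix.toLin (.finTwoProd ℝ) (.finTwoProd ℝ) !![u 0, w 0; u 1, w 1]
  have hM : LinearMap.det M = cross u w := by
    rw [LinearMap.det_toLin, Matrix.det_fin_two_of, cross]; ring
  have hMa : ∀ p, M p = (u 0 * p.1 + w 0 * p.2, u 1 * p.1 + w 1 * p.2) := by
    intro p
    simp [M, Matrix.toLin_finTwoProd_apply]
  let e : ℝ × ℝ → Plane := fun p => WithLp.toLp 2 ((MeasurableEquiv.finTwoArrow (α := ℝ)).symm p)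
  have he : MeasurePreserving e :=
    (EuclideanSpace.volume_preserving_symm_measurableEquiv_toLp (Fin 2)).symm.comp
      (volume_preserving_finTwoArrow ℝ).symm
  have ht : MeasurePreserving (fun x : Plane => a + x) := measurePreserving_add_left volume a
  have hcomp : affineParam a u w = (fun x : Plane => a + x) ∘ e ∘ M := by
    funext p
    ext i
    simp only [affineParam, Function.comp_apply, hMa]
    fin_cases i <;> simp [e, MeasurableEquiv.finTwoArrow] <;> ring
  have hMm : Measurable M := M.continuous_of_finiteDimensional.measurable
  rw [hcomp, ← Measure.map_map ht.measurable (he.measurable.comp hMm),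
    ← Measure.map_map he.measurable hMm,
    Measure.map_linearMap_addHaar_eq_smul_addHaar volume (by rwa [hM]), hM, Measure.map_smul,
    he.map_eq, Measure.map_smul, ht.map_eq, abs_inv]

theorem setIntegral_eq_affineParam {a u w : Plane} (h : cross u w ≠ 0) (S : Set Plane)
    (H : Plane → ℝ) :
    ∫ x in S, H x = |cross u w| * ∫ p in affineParam a u w ⁻¹' S, H (affineParam a u w p) := by
  rw [← (measurableEmbedding_affineParam h).setIntegral_map, map_affineParam_volume h,
    Measure.restrict_smul, integral_smul_measure, ENNReal.toReal_ofReal (by positivity),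
    smul_eq_mul, mul_inv_cancel_left₀ (abs_ne_zero.2 h)]

/-! ### Iterated integrals over the reference triangle -/

/-- The open triangle with vertices `(0, 0)`, `(1, 0)` and `(0, 1)`. -/
def refTriangle : Set (ℝ × ℝ) := {p | 0 < p.1 ∧ 0 < p.2 ∧ p.1 + p.2 < 1}

theorem isOpen_refTriangle : IsOpen refTriangle :=
  (isOpen_lt continuous_const continuous_fst).inter
    ((isOpen_lt continuous_const continuous_snd).inter
      (isOpen_lt (continuous_fst.add continuous_snd) continuous_const))

theorem refTriangle_subset : refTriangle ⊆ Set.Icc (0 : ℝ) 1 ×ˢ Set.Icc (0 : ℝ) 1 := by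
  rintro ⟨x, y⟩ ⟨h1, h2, h3⟩
  simp only at h1 h2 h3
  exact ⟨⟨h1.le, by linarith⟩, ⟨h2.le, by linarith⟩⟩

theorem integrableOn_refTriangle {H : ℝ × ℝ → ℝ} (hH : Continuous H) :
    IntegrableOn H refTriangle :=
  (hH.continuousOn.integrableOn_compact (isCompact_Icc.prod isCompact_Icc)).mono_set
    refTriangle_subset

theorem integral_indicator_refTriangle (H : ℝ → ℝ) (y : ℝ) :
    ∫ x, {x : ℝ | 0 < x ∧ 0 < y ∧ x + y < 1}.indicator H x =
      (Set.Ioc (0 : ℝ) 1).indicator (fun y => ∫ x in (0 : ℝ)..(1 - y), H x) y := by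
  have hset : {x : ℝ | 0 < x ∧ 0 < y ∧ x + y < 1} = if 0 < y then Set.Ioo 0 (1 - y) else ∅ := by
    ext x
    split_ifs with h
    · simp only [Set.mem_ofPred_eq, Set.mem_Ioo, h, true_and, lt_sub_iff_add_lt]
    · simp [h]
  rw [hset]
  by_cases hy : y ∈ Set.Ioc (0 : ℝ) 1
  · rw [if_pos hy.1, Set.indicator_of_mem hy, integral_indicator measurableSet_Ioo,
      intervalIntegral.integral_of_le (by linarith [hy.2]), integral_Ioc_eq_integral_Ioo]
  · rw [Set.indicator_of_notMem hy]
    split_ifs with h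
    · have : ¬ y ≤ 1 := fun h' => hy ⟨h, h'⟩
      rw [Set.Ioo_eq_empty (by linarith)]
      simp
    · simp

theorem integral_refTriangle_fst {H : ℝ × ℝ → ℝ} (hH : Continuous H) :
    ∫ p in refTriangle, H p = ∫ y in (0 : ℝ)..1, ∫ x in (0 : ℝ)..(1 - y), H (x, y) := by
  rw [← integral_indicator isOpen_refTriangle.measurableSet, Measure.volume_eq_prod,
    integral_prod_symm _ ((integrable_indicator_iff isOpen_refTriangle.measurableSet).2
      (integrableOn_refTriangle hH)), intervalIntegral.integral_of_le zero_le_one,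
    ← integral_indicator measurableSet_Ioc]
  congr 1
  funext y
  exact integral_indicator_refTriangle (fun x => H (x, y)) y

theorem integral_refTriangle_snd {H : ℝ × ℝ → ℝ} (hH : Continuous H) :
    ∫ p in refTriangle, H p = ∫ x in (0 : ℝ)..1, ∫ y in (0 : ℝ)..(1 - x), H (x, y) := by
  rw [← integral_indicator isOpen_refTriangle.measurableSet, Measure.volume_eq_prod,
    integral_prod _ ((integrable_indicator_iff isOpen_refTriangle.measurableSet).2
      (integrableOn_refTriangle hH)), intervalIntegral.integral_of_le zero_le_one,
    ← integral_indicator measurableSet_Ioc]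
  congr 1
  funext x
  refine Eq.trans ?_ ((integral_indicator_refTriangle (fun y => H (x, y)) x).trans
    (by simp only [Set.indicator_apply]))
  congr 1
  funext y
  have : (x, y) ∈ refTriangle ↔ y ∈ {y : ℝ | 0 < y ∧ 0 < x ∧ y + x < 1} := by
    simp only [refTriangle, Set.mem_ofPred_eq, add_comm y]
    tauto
  by_cases h : (x, y) ∈ refTriangle
  · rw [Set.indicator_of_mem h, Set.indicator_of_mem (this.1 h)]
  · rw [Set.indicator_of_notMem h, Set.indicator_of_notMem (fun h' => h (this.2 h'))]

/-! ### Directional derivatives -/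

/-- The derivative of `f` in the direction `e`. -/
def dirDeriv (e : Plane) (f : Plane → ℝ) : Plane → ℝ := fun x => fderiv ℝ f x e

theorem contDiff_dirDeriv {f : Plane → ℝ} (hf : ContDiff ℝ ∞ f) (e : Plane) :
    ContDiff ℝ ∞ (dirDeriv e f) :=
  (hf.fderiv_right (m := ∞) le_rfl).clm_apply contDiff_const

theorem dirDeriv_dirDeriv_apply {f : Plane → ℝ} (hf : ContDiff ℝ ∞ f) (e e' x : Plane) :
    dirDeriv e (dirDeriv e' f) x = fderiv ℝ (fderiv ℝ f) x e e' := by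
  have hd : Differentiable ℝ (fderiv ℝ f) :=
    (hf.fderiv_right (m := ∞) le_rfl).differentiable (by simp)
  change fderiv ℝ (fun y => fderiv ℝ f y e') x e = _
  rw [fderiv_clm_apply (hd x) (differentiableAt_const e')]
  simp

theorem dirDeriv_comm {f : Plane → ℝ} (hf : ContDiff ℝ ∞ f) (e e' : Plane) :
    dirDeriv e (dirDeriv e' f) = dirDeriv e' (dirDeriv e f) := by
  funext x
  rw [dirDeriv_dirDeriv_apply hf, dirDeriv_dirDeriv_apply hf]
  refine (hf.contDiffAt.isSymmSndFDerivAt ?_) e e'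
  simpa using WithTop.coe_le_coe.2 (le_top : (2 : ℕ∞) ≤ ⊤)

theorem dirDeriv_add_smul (e e' : Plane) (r r' : ℝ) (f : Plane → ℝ) (x : Plane) :
    dirDeriv (r • e + r' • e') f x = r * dirDeriv e f x + r' * dirDeriv e' f x := by
  simp [dirDeriv]

theorem dirDeriv_sub_left (e e' : Plane) (f : Plane → ℝ) (x : Plane) :
    dirDeriv (e - e') f x = dirDeriv e f x - dirDeriv e' f x := by
  simp [dirDeriv]

theorem dirDeriv_dirDeriv_add_smul {f : Plane → ℝ} (hf : ContDiff ℝ ∞ f) (d e e' : Plane)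
    (r r' : ℝ) (x : Plane) : dirDeriv d (dirDeriv (r • e + r' • e') f) x =
      r * dirDeriv d (dirDeriv e f) x + r' * dirDeriv d (dirDeriv e' f) x := by
  simp [dirDeriv_dirDeriv_apply hf]

theorem hasDerivAt_comp_line {f : Plane → ℝ} (hf : ContDiff ℝ ∞ f) (a e : Plane) (t : ℝ) :
    HasDerivAt (fun t : ℝ => f (a + t • e)) (dirDeriv e f (a + t • e)) t := by
  have h1 : HasDerivAt (fun t : ℝ => a + t • e) e t := by
    simpa using ((hasDerivAt_id t).smul_const e).const_add a
  exact ((hf.differentiable (by simp) _).hasFDerivAt).comp_hasDerivAt t h1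

theorem integral_dirDeriv_line {f : Plane → ℝ} (hf : ContDiff ℝ ∞ f) (a e : Plane) (r : ℝ) :
    ∫ t in (0 : ℝ)..r, dirDeriv e f (a + t • e) = f (a + r • e) - f a := by
  rw [intervalIntegral.integral_eq_sub_of_hasDerivAt (fun t _ => hasDerivAt_comp_line hf a e t)]
  · simp
  · refine Continuous.intervalIntegrable ?_ _ _
    exact (contDiff_dirDeriv hf e).continuous.comp (by fun_prop)

/-! ### Green's formula on a triangle -/

/-- The divergence theorem on a triangle, in affine coordinates. -/
theorem integral_refTriangle_divergence {F G : Plane → ℝ} (hF : ContDiff ℝ ∞ F)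
    (hG : ContDiff ℝ ∞ G) (a u w : Plane) :
    ∫ p in refTriangle, (dirDeriv u F + dirDeriv w G) (affineParam a u w p) =
      ∫ t in (0 : ℝ)..1, (F (a + t • w + (1 - t) • u) - F (a + t • w) +
        (G (a + t • w + (1 - t) • u) - G (a + t • u))) := by
  have hc := continuous_affineParam a u w
  have hFc := (contDiff_dirDeriv hF u).continuous.comp hc
  have hGc := (contDiff_dirDeriv hG w).continuous.comp hc
  have h1 : ∫ p in refTriangle, dirDeriv u F (affineParam a u w p) =
      ∫ t in (0 : ℝ)..1, (F (a + t • w + (1 - t) • u) - F (a + t • w)) := by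
    refine (integral_refTriangle_fst hFc).trans (intervalIntegral.integral_congr fun y _ => ?_)
    rw [← integral_dirDeriv_line hF]
    refine intervalIntegral.integral_congr fun x _ => ?_
    simp only [affineParam, Function.comp_apply]
    congr 1; abel
  have h2 : ∫ p in refTriangle, dirDeriv w G (affineParam a u w p) =
      ∫ t in (0 : ℝ)..1, (G (a + t • w + (1 - t) • u) - G (a + t • u)) := by
    have h3 : ∫ p in refTriangle, dirDeriv w G (affineParam a u w p) =
        ∫ t in (0 : ℝ)..1, (G (a + t • u + (1 - t) • w) - G (a + t • u)) := by
      refine (integral_refTriangle_snd hGc).trans (intervalIntegral.integral_congr fun x _ => ?_)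
      rw [← integral_dirDeriv_line hG]
      rfl
    rw [h3, intervalIntegral.integral_sub, intervalIntegral.integral_sub, ← integral_reflect]
    · congr 1
      refine intervalIntegral.integral_congr fun t _ => ?_
      congr 1
      rw [sub_sub_cancel]; abel
    all_goals
      refine Continuous.intervalIntegrable ?_ _ _
      exact hG.continuous.comp (by fun_prop)
  have hi := integral_add (μ := volume.restrict refTriangle) (integrableOn_refTriangle hFc)
    (integrableOn_refTriangle hGc)
  refine hi.trans ?_
  rw [intervalIntegral.integral_add]
  · exact congrArg₂ (· + ·) h1 h2
  · refine Continuous.intervalIntegrable ?_ _ _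
    exact (hF.continuous.comp (by fun_prop)).sub (hF.continuous.comp (by fun_prop))
  · refine Continuous.intervalIntegrable ?_ _ _
    exact (hG.continuous.comp (by fun_prop)).sub (hG.continuous.comp (by fun_prop))

/-- The density of the boundary form of `2 det D²f` on an edge with direction `e`, in terms of a
transversal direction `d`. It is linear in `d` and vanishes for `d = e`. -/
def boundaryDensity (e d : Plane) (f : Plane → ℝ) (x : Plane) : ℝ :=
  dirDeriv d f x * dirDeriv e (dirDeriv e f) x - dirDeriv e f x * dirDeriv e (dirDeriv d f) x

/-- The contribution of the edge with endpoints `a` and `b` to Green's formula for `2 det D²f` on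
the triangle with vertices `a`, `b` and `c`. -/
def edgeTerm (f : Plane → ℝ) (a b c : Plane) : ℝ :=
  |cross (b - a) (c - a)|⁻¹ *
    ∫ t in (0 : ℝ)..1, boundaryDensity (b - a) (c - a) f (AffineMap.lineMap a b t)

theorem dirDeriv_mul {f g : Plane → ℝ} (hf : ContDiff ℝ ∞ f) (hg : ContDiff ℝ ∞ g) (e x : Plane) :
    dirDeriv e (f * g) x = dirDeriv e f x * g x + f x * dirDeriv e g x := by
  rw [dirDeriv, fderiv_mul (hf.differentiable (by simp) _) (hg.differentiable (by simp) _)]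
  simp only [add_apply, smul_apply, smul_eq_mul, dirDeriv]
  ring

theorem dirDeriv_sub {f g : Plane → ℝ} (hf : ContDiff ℝ ∞ f) (hg : ContDiff ℝ ∞ g) (e x : Plane) :
    dirDeriv e (f - g) x = dirDeriv e f x - dirDeriv e g x := by
  rw [dirDeriv, fderiv_sub (hf.differentiable (by simp) _) (hg.differentiable (by simp) _)]
  rfl

theorem cross_rotate (a b c : Plane) : cross (c - b) (a - b) = cross (b - a) (c - a) := by
  simp only [cross, PiLp.sub_apply]; ring

theorem continuous_boundaryDensity {f : Plane → ℝ} (hf : ContDiff ℝ ∞ f) (e d : Plane) :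
    Continuous (boundaryDensity e d f) := by
  have h1 := fun e => (contDiff_dirDeriv hf e).continuous
  have h2 := fun e d => (contDiff_dirDeriv (contDiff_dirDeriv hf e) d).continuous
  exact ((h1 _).mul (h2 _ _)).sub ((h1 _).mul (h2 _ _))

/-- Green's formula: in affine coordinates, `2 det D²f` is the divergence of the vector field
`(f_x f_yy - f_y f_xy, f_y f_xx - f_x f_xy)`. -/
theorem integral_refTriangle_hessianDet {f : Plane → ℝ} (hf : ContDiff ℝ ∞ f) (a u w : Plane) :
    2 * ∫ p in refTriangle, (dirDeriv u (dirDeriv u f) * dirDeriv w (dirDeriv w f) -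
        dirDeriv u (dirDeriv w f) ^ 2) (affineParam a u w p) =
      -((∫ t in (0 : ℝ)..1, boundaryDensity u w f (a + t • u)) +
        (∫ t in (0 : ℝ)..1, boundaryDensity (w - u) (-u) f (a + t • w + (1 - t) • u)) +
        ∫ t in (0 : ℝ)..1, boundaryDensity (-w) (u - w) f (a + t • w)) := by
  have hu := contDiff_dirDeriv hf u
  have hw := contDiff_dirDeriv hf w
  have huu := contDiff_dirDeriv hu u
  have huw := contDiff_dirDeriv hw u
  have hww := contDiff_dirDeriv hw w
  have h₁ : ContDiff ℝ ∞ (dirDeriv u f * dirDeriv w (dirDeriv w f)) := hu.mul hww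
  have h₂ : ContDiff ℝ ∞ (dirDeriv w f * dirDeriv u (dirDeriv w f)) := hw.mul huw
  have h₃ : ContDiff ℝ ∞ (dirDeriv w f * dirDeriv u (dirDeriv u f)) := hw.mul huu
  have h₄ : ContDiff ℝ ∞ (dirDeriv u f * dirDeriv u (dirDeriv w f)) := hu.mul huw
  have h := integral_refTriangle_divergence
    (F := dirDeriv u f * dirDeriv w (dirDeriv w f) - dirDeriv w f * dirDeriv u (dirDeriv w f))
    (G := dirDeriv w f * dirDeriv u (dirDeriv u f) - dirDeriv u f * dirDeriv u (dirDeriv w f))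
    (h₁.sub h₂) (h₃.sub h₄) a u w
  rw [← integral_const_mul]
  refine Eq.trans ?_ (h.trans ?_)
  · congr 1
    funext p
    simp only [Pi.add_apply, Pi.sub_apply, Pi.mul_apply, Pi.pow_apply]
    rw [dirDeriv_sub h₁ h₂, dirDeriv_sub h₃ h₄,
      dirDeriv_mul hu hww, dirDeriv_mul hw huw, dirDeriv_mul hw huu, dirDeriv_mul hu huw,
      dirDeriv_comm hw w u, dirDeriv_comm hf w u, dirDeriv_comm hu w u, dirDeriv_comm hf w u]
    ring
  · rw [← intervalIntegral.integral_add, ← intervalIntegral.integral_add,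
      ← intervalIntegral.integral_neg]
    · refine intervalIntegral.integral_congr fun t _ => ?_
      have hneg : ∀ (e : Plane) (g : Plane → ℝ), dirDeriv (-e) g = -dirDeriv e g := by
        intro e g; funext x; simp [dirDeriv]
      have h1 : ∀ (e : Plane) (x : Plane), dirDeriv e (-dirDeriv u f) x =
          -dirDeriv e (dirDeriv u f) x := by
        intro e x
        have := dirDeriv_dirDeriv_add_smul hf e u 0 (-1) 0 x
        simpa [hneg] using this
      have h2 : ∀ (e : Plane) (x : Plane), dirDeriv e (-dirDeriv w f) x =
          -dirDeriv e (dirDeriv w f) x := by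
        intro e x
        have := dirDeriv_dirDeriv_add_smul hf e w 0 (-1) 0 x
        simpa [hneg] using this
      have h3 : ∀ (e d d' : Plane) (x : Plane), dirDeriv e (dirDeriv (d - d') f) x =
          dirDeriv e (dirDeriv d f) x - dirDeriv e (dirDeriv d' f) x := by
        intro e d d' x
        simp [dirDeriv_dirDeriv_apply hf]
      simp only [boundaryDensity, Pi.sub_apply, Pi.mul_apply, hneg, Pi.neg_apply, h1,
        h2, h3, dirDeriv_sub_left, dirDeriv_comm hf w u]
      ring
    all_goals
      refine Continuous.intervalIntegrable ?_ _ _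
      first
      | exact (continuous_boundaryDensity hf _ _).comp (by fun_prop)
      | exact ((continuous_boundaryDensity hf _ _).comp (by fun_prop)).add
          ((continuous_boundaryDensity hf _ _).comp (by fun_prop))

theorem iteratedFDeriv_two_eq_dirDeriv {f : Plane → ℝ} (hf : ContDiff ℝ ∞ f) (x e e' : Plane) :
    iteratedFDeriv ℝ 2 f x ![e, e'] = dirDeriv e (dirDeriv e' f) x := by
  rw [iteratedFDeriv_two_apply, dirDeriv_dirDeriv_apply hf]
  rfl

/-- The difference `|D²f|² - (Δf)²` is `-2 det D²f`, expressed by derivatives in the directions `u`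
and `w`. -/
theorem norm_hessian_sq_sub_laplacian_sq {f : Plane → ℝ} (hf : ContDiff ℝ ∞ f) (x u w : Plane) :
    cross u w ^ 2 * (‖hessian f x‖ ^ 2 - Laplacian.laplacian f x ^ 2) =
      -2 * (dirDeriv u (dirDeriv u f) x * dirDeriv w (dirDeriv w f) x -
        dirDeriv u (dirDeriv w f) x ^ 2) := by
  have hx : ∀ v : Plane, v = v 0 • EuclideanSpace.single (0 : Fin 2) (1 : ℝ) +
      v 1 • EuclideanSpace.single (1 : Fin 2) (1 : ℝ) := by
    intro v
    ext i; fin_cases i <;> simp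
  set e₀ : Plane := EuclideanSpace.single 0 1
  set e₁ : Plane := EuclideanSpace.single 1 1
  have h2 : ∀ v v' : Plane, dirDeriv v (dirDeriv v' f) x =
      v 0 * (v' 0 * dirDeriv e₀ (dirDeriv e₀ f) x + v' 1 * dirDeriv e₀ (dirDeriv e₁ f) x) +
      v 1 * (v' 0 * dirDeriv e₀ (dirDeriv e₁ f) x + v' 1 * dirDeriv e₁ (dirDeriv e₁ f) x) := by
    intro v v'
    have h := dirDeriv_comm hf e₁ e₀
    conv_lhs => rw [hx v, hx v', dirDeriv_add_smul, dirDeriv_dirDeriv_add_smul hf,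
      dirDeriv_dirDeriv_add_smul hf, h]
  have hl : Laplacian.laplacian f x =
      dirDeriv e₀ (dirDeriv e₀ f) x + dirDeriv e₁ (dirDeriv e₁ f) x := by
    rw [InnerProductSpace.laplacian_eq_iteratedFDeriv_orthonormalBasis f
      (EuclideanSpace.basisFun (Fin 2) ℝ)]
    simp only [EuclideanSpace.basisFun_apply, Fin.sum_univ_two, iteratedFDeriv_two_eq_dirDeriv hf]
    rfl
  have hh : ‖hessian f x‖ ^ 2 = dirDeriv e₀ (dirDeriv e₀ f) x ^ 2 +
      2 * dirDeriv e₀ (dirDeriv e₁ f) x ^ 2 + dirDeriv e₁ (dirDeriv e₁ f) x ^ 2 := by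
    rw [EuclideanSpace.real_norm_sq_eq, Fintype.sum_prod_type]
    simp only [hessian, Fin.sum_univ_two, iteratedFDeriv_two_eq_dirDeriv hf]
    change dirDeriv e₀ (dirDeriv e₀ f) x ^ 2 + dirDeriv e₀ (dirDeriv e₁ f) x ^ 2 +
      (dirDeriv e₁ (dirDeriv e₀ f) x ^ 2 + dirDeriv e₁ (dirDeriv e₁ f) x ^ 2) = _
    rw [dirDeriv_comm hf e₁ e₀]
    ring
  rw [hl, hh, h2 u u, h2 w w, h2 u w, cross]
  ring

/-! ### Barycentric coordinates as affine coordinates -/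

theorem coord_affineParam (T : AffineBasis (Fin 3) ℝ Plane) (i : Fin 3) (p : ℝ × ℝ) :
    T.coord i (affineParam (T 0) (T 1 - T 0) (T 2 - T 0) p) =
      (1 - p.1 - p.2) * T.coord i (T 0) + p.1 * T.coord i (T 1) + p.2 * T.coord i (T 2) := by
  have h : ∀ x, T.coord i x = (T.coord i).linear x + T.coord i 0 := fun x =>
    congrFun (T.coord i).decomp x
  rw [h (affineParam _ _ _ _), h (T 0), h (T 1), h (T 2)]
  simp only [affineParam, map_add, map_smul, map_sub, smul_eq_mul]
  ring

theorem cross_ne_zero (T : AffineBasis (Fin 3) ℝ Plane) :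
    cross (T 1 - T 0) (T 2 - T 0) ≠ 0 := by
  intro h
  have hp : ∀ p : ℝ × ℝ, p.1 • (T 1 - T 0) + p.2 • (T 2 - T 0) = 0 → p.1 = 0 ∧ p.2 = 0 := by
    intro p hp
    have h1 := coord_affineParam T 1 p
    have h2 := coord_affineParam T 2 p
    rw [affineParam, add_assoc, hp, add_zero] at h1 h2
    simp at h1 h2
    exact ⟨h1.symm, h2.symm⟩
  rw [cross] at h
  have h1 := hp ((T 2 - T 0) 1, -(T 1 - T 0) 1) (by
    ext i; fin_cases i
    · simp at h ⊢; linear_combination h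
    · simp; ring)
  have h0 := hp ((T 2 - T 0) 0, -(T 1 - T 0) 0) (by
    ext i; fin_cases i
    · simp; ring
    · simp at h ⊢; linear_combination -h)
  have hw : T 2 - T 0 = 0 := by
    ext i; fin_cases i
    · exact h0.1
    · exact h1.1
  have := hp (0, 1) (by simp [hw])
  simp at this

theorem affineParam_preimage_interior (T : AffineBasis (Fin 3) ℝ Plane) :
    affineParam (T 0) (T 1 - T 0) (T 2 - T 0) ⁻¹' interior (convexHull ℝ (Set.range T)) =
      refTriangle := by
  ext p
  rw [T.interior_convexHull, Set.mem_preimage, Set.mem_ofPred_eq, Fin.forall_fin_succ,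
    Fin.forall_fin_two]
  simp only [coord_affineParam, AffineBasis.coord_apply, refTriangle, Set.mem_ofPred_eq]
  simp only [Fin.isValue, Fin.succ_zero_eq_one, Fin.succ_one_eq_two]
  simp
  constructor
  · rintro ⟨h1, h2, h3⟩; exact ⟨h2, h3, by linarith⟩
  · rintro ⟨h1, h2, h3⟩; exact ⟨by linarith, h1, h2⟩

/-- Green's formula for the difference of the squared norms of Hessian and Laplacian. -/
theorem integral_norm_hessian_sq_sub_laplacian_sq {f : Plane → ℝ} (hf : ContDiff ℝ ∞ f)
    (T : AffineBasis (Fin 3) ℝ Plane) :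
    ∫ x in interior (convexHull ℝ (Set.range T)),
        (‖hessian f x‖ ^ 2 - Laplacian.laplacian f x ^ 2) =
      edgeTerm f (T 0) (T 1) (T 2) + edgeTerm f (T 1) (T 2) (T 0) +
        edgeTerm f (T 2) (T 0) (T 1) := by
  have hD := cross_ne_zero T
  have hg := integral_refTriangle_hessianDet hf (T 0) (T 1 - T 0) (T 2 - T 0)
  rw [setIntegral_eq_affineParam hD, affineParam_preimage_interior]
  set D := cross (T 1 - T 0) (T 2 - T 0)
  have h1 : ∀ x, ‖hessian f x‖ ^ 2 - Laplacian.laplacian f x ^ 2 = -(2 * (D ^ 2)⁻¹) *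
      (dirDeriv (T 1 - T 0) (dirDeriv (T 1 - T 0) f) *
          dirDeriv (T 2 - T 0) (dirDeriv (T 2 - T 0) f) -
        dirDeriv (T 1 - T 0) (dirDeriv (T 2 - T 0) f) ^ 2) x := by
    intro x
    have := norm_hessian_sq_sub_laplacian_sq hf x (T 1 - T 0) (T 2 - T 0)
    simp only [Pi.sub_apply, Pi.mul_apply, Pi.pow_apply]
    field_simp
    linear_combination this
  have hc0 : cross (T 1 - T 0) (T 2 - T 0) = D := rfl
  have hc1 : cross (T 2 - T 1) (T 0 - T 1) = D := cross_rotate _ _ _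
  have hc2 : cross (T 0 - T 2) (T 1 - T 2) = D := by rw [cross_rotate, cross_rotate]
  have e1 : T 2 - T 0 - (T 1 - T 0) = T 2 - T 1 := by abel
  have e2 : -(T 1 - T 0) = T 0 - T 1 := by abel
  have e3 : -(T 2 - T 0) = T 0 - T 2 := by abel
  have e4 : T 1 - T 0 - (T 2 - T 0) = T 1 - T 2 := by abel
  rw [e1, e2, e3, e4] at hg
  have hr := integral_reflect fun t => boundaryDensity (T 0 - T 2) (T 1 - T 2) f
    (T 0 + t • (T 2 - T 0))
  have l1 : ∀ t : ℝ, T 0 + t • (T 1 - T 0) = AffineMap.lineMap (T 0) (T 1) t := fun t => by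
    rw [AffineMap.lineMap_apply, vsub_eq_sub, vadd_eq_add, add_comm]
  have l2 : ∀ t : ℝ, T 0 + t • (T 2 - T 0) + (1 - t) • (T 1 - T 0) =
      AffineMap.lineMap (T 1) (T 2) t := fun t => by
    rw [AffineMap.lineMap_apply, vsub_eq_sub, vadd_eq_add]; module
  have l3 : ∀ t : ℝ, T 0 + (1 - t) • (T 2 - T 0) =
      AffineMap.lineMap (T 2) (T 0) t := fun t => by
    rw [AffineMap.lineMap_apply, vsub_eq_sub, vadd_eq_add]; module
  rw [← hr] at hg
  simp only [l1, l2, l3] at hg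
  simp only [h1, integral_const_mul, edgeTerm, hc0, hc1, hc2]
  rw [← mul_add, ← mul_add, ← neg_eq_iff_eq_neg.2 hg, ← sq_abs D]
  have := abs_ne_zero.2 hD
  field_simp

/-! ### The elements at an edge -/

theorem cross_self (u : Plane) : cross u u = 0 := by
  simp only [cross]; ring

/-- Every vector is a combination of a transversal vector `w` and `u`. -/
theorem eq_smul_add_smul {u w : Plane} (h : cross u w ≠ 0) (d : Plane) :
    d = (cross u d / cross u w) • w + (cross d w / cross u w) • u := by
  rw [cross] at h
  ext i
  fin_cases i <;>
    simp only [cross, PiLp.add_apply, PiLp.smul_apply, smul_eq_mul, Fin.zero_eta, Fin.mk_one] <;>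
    field_simp <;> ring

/-- Near an interior point of the edge with direction `T 1 - T 0`, all points on the side of the
third vertex belong to the interior of the triangle. -/
theorem eventually_mem_interior (T : AffineBasis (Fin 3) ℝ Plane) {d : Plane}
    (hd : 0 < cross (T 1 - T 0) d * cross (T 1 - T 0) (T 2 - T 0)) {t₀ : ℝ}
    (ht₀ : t₀ ∈ Set.Ioo (0 : ℝ) 1) :
    ∀ᶠ p : ℝ × ℝ in 𝓝 (t₀, 0), 0 < p.2 →
      affineParam (T 0) (T 1 - T 0) d p ∈ interior (convexHull ℝ (Set.range T)) := by
  have hD := cross_ne_zero T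
  have hdec := eq_smul_add_smul hD d
  set β := cross (T 1 - T 0) d / cross (T 1 - T 0) (T 2 - T 0) with hβ
  set α := cross d (T 2 - T 0) / cross (T 1 - T 0) (T 2 - T 0)
  have hβ0 : 0 < β := by
    rw [hβ, div_eq_mul_inv]
    have := mul_pos hd (sq_pos_of_ne_zero (inv_ne_zero hD))
    field_simp at this ⊢
    exact this
  have hΦ : ∀ p : ℝ × ℝ, affineParam (T 0) (T 1 - T 0) d p =
      affineParam (T 0) (T 1 - T 0) (T 2 - T 0) (p.1 + p.2 * α, p.2 * β) := by
    intro p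
    rw [affineParam, hdec, affineParam]
    module
  have h1 : ∀ᶠ p : ℝ × ℝ in 𝓝 (t₀, 0), 0 < p.1 + p.2 * α := by
    have hc : Continuous fun p : ℝ × ℝ => p.1 + p.2 * α := by fun_prop
    exact hc.continuousAt.eventually_const_lt (by simpa using ht₀.1)
  have h2 : ∀ᶠ p : ℝ × ℝ in 𝓝 (t₀, 0), p.1 + p.2 * α + p.2 * β < 1 := by
    have hc : Continuous fun p : ℝ × ℝ => p.1 + p.2 * α + p.2 * β := by fun_prop
    exact hc.continuousAt.eventually_lt_const (by simpa using ht₀.2)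
  filter_upwards [h1, h2] with p hp1 hp2 hp
  rw [hΦ, ← Set.mem_preimage, affineParam_preimage_interior]
  exact ⟨hp1, mul_pos hp hβ0, hp2⟩

namespace Triangulation

variable {Ω : Set Plane} {𝒯 : Triangulation Ω}

theorem third_notMem {s₁ s₂ : Finset Plane} (h₁ : s₁ ∈ 𝒯.elements) (h₂ : s₂ ∈ 𝒯.elements)
    (hne : s₁ ≠ s₂) {T : AffineBasis (Fin 3) ℝ Plane} (hT : (s₁ : Set Plane) = Set.range T)
    (h0 : T 0 ∈ s₂) (h1 : T 1 ∈ s₂) : T 2 ∉ s₂ := by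
  intro h2
  refine hne (Finset.eq_of_subset_of_card_le (fun x hx => ?_) ?_)
  · rw [← Finset.mem_coe, hT] at hx
    obtain ⟨i, rfl⟩ := hx
    fin_cases i <;> assumption
  · rw [(Finset.mem_filter.1 h₁).2, (Finset.mem_filter.1 h₂).2]

/-- Two distinct elements that share an edge lie on opposite sides of this edge. -/
theorem cross_mul_cross_neg {s₁ s₂ : Finset Plane} (h₁ : s₁ ∈ 𝒯.elements) (h₂ : s₂ ∈ 𝒯.elements)
    (hne : s₁ ≠ s₂) {T₁ T₂ : AffineBasis (Fin 3) ℝ Plane} (hT₁ : (s₁ : Set Plane) = Set.range T₁)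
    (hT₂ : (s₂ : Set Plane) = Set.range T₂) (h0 : T₁ 0 = T₂ 0) (h1 : T₁ 1 = T₂ 1) :
    cross (T₁ 1 - T₁ 0) (T₁ 2 - T₁ 0) * cross (T₁ 1 - T₁ 0) (T₂ 2 - T₁ 0) < 0 := by
  by_contra! hcon
  have hD₁ := cross_ne_zero T₁
  have hD₂ := cross_ne_zero T₂
  have hpos : 0 < cross (T₂ 1 - T₂ 0) (T₁ 2 - T₁ 0) * cross (T₂ 1 - T₂ 0) (T₂ 2 - T₂ 0) := by
    rw [← h0, ← h1] at hD₂ ⊢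
    exact lt_of_le_of_ne hcon (mul_ne_zero hD₁ hD₂).symm
  have ht : (1 / 2 : ℝ) ∈ Set.Ioo (0 : ℝ) 1 := by norm_num
  have hev := (eventually_mem_interior T₁ (mul_self_pos.2 hD₁) ht).and
    (eventually_mem_interior T₂ hpos ht)
  have hline : Tendsto (fun ε : ℝ => ((1 / 2 : ℝ), ε)) (𝓝[>] 0) (𝓝 (1 / 2, 0)) :=
    ((continuous_const.prodMk continuous_id).tendsto' _ _ rfl).mono_left nhdsWithin_le_nhds
  obtain ⟨ε, ⟨hε1, hε2⟩, hε⟩ := ((hline.eventually hev).and self_mem_nhdsWithin).exists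
  have hε : 0 < ε := hε
  have hx1 := interior_subset (hε1 hε)
  have hx2 := interior_subset (hε2 hε)
  rw [← h0, ← h1, ← hT₂] at hx2
  rw [← hT₁] at hx1
  have hx := 𝒯.inter_subset_convexHull (mem_faces h₁) (mem_faces h₂) ⟨hx1, hx2⟩
  -- The third barycentric coordinate vanishes on the hull of the common vertices.
  have hsub : (s₁ ∩ s₂ : Set Plane) ⊆ {x | T₁.coord 2 x = 0} := by
    rintro x ⟨hx1, hx2⟩
    rw [hT₁] at hx1
    obtain ⟨i, rfl⟩ := hx1
    have h2 : T₁ 2 ∉ s₂ := third_notMem h₁ h₂ hne hT₁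
      (by rw [h0, ← Finset.mem_coe, hT₂]; exact ⟨0, rfl⟩)
      (by rw [h1, ← Finset.mem_coe, hT₂]; exact ⟨1, rfl⟩)
    have hi : i ≠ 2 := by
      rintro rfl; exact h2 hx2
    simp [hi.symm]
  have hconv : Convex ℝ {x | T₁.coord 2 x = 0} :=
    (convex_singleton (0 : ℝ)).affine_preimage (T₁.coord 2)
  have h3 := convexHull_min hsub hconv hx
  rw [Set.mem_ofPred_eq, coord_affineParam] at h3
  simp at h3
  exact hε.ne' h3

/-- A face whose hull contains an interior point of an edge contains the endpoints of this edge. -/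
theorem mem_face_of_lineMap_mem {s₁ s : Finset Plane} (h₁ : s₁ ∈ 𝒯.elements) (hs : s ∈ 𝒯.faces)
    {T : AffineBasis (Fin 3) ℝ Plane} (hT : (s₁ : Set Plane) = Set.range T) {t : ℝ}
    (ht : t ∈ Set.Ioo (0 : ℝ) 1)
    (hx : affineParam (T 0) (T 1 - T 0) (T 2 - T 0) (t, 0) ∈ convexHull ℝ (s : Set Plane)) :
    T 0 ∈ s ∧ T 1 ∈ s := by
  set x := affineParam (T 0) (T 1 - T 0) (T 2 - T 0) (t, 0) with hxdef
  have hc0 : T.coord 0 x = 1 - t := by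
    rw [hxdef, coord_affineParam]; simp
  have hc1 : T.coord 1 x = t := by
    rw [hxdef, coord_affineParam]; simp
  have hc2 : T.coord 2 x = 0 := by
    rw [hxdef, coord_affineParam]; simp
  have hx1 : x ∈ convexHull ℝ (s₁ : Set Plane) := by
    rw [hT, T.convexHull_eq_nonneg_coord, Set.mem_ofPred_eq, Fin.forall_fin_succ,
      Fin.forall_fin_two]
    exact ⟨by rw [hc0]; linarith [ht.2], by
      change 0 ≤ T.coord 1 x
      rw [hc1]; exact ht.1.le, by
      change 0 ≤ T.coord 2 x
      rw [hc2]⟩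
  have hx := 𝒯.inter_subset_convexHull (mem_faces h₁) hs ⟨hx1, hx⟩
  have key : ∀ i : Fin 3, T i ∉ s → T.coord i x = 0 := by
    intro i hi
    have hsub : (s₁ ∩ s : Set Plane) ⊆ {x | T.coord i x = 0} := by
      rintro y ⟨hy1, hy2⟩
      rw [hT] at hy1
      obtain ⟨j, rfl⟩ := hy1
      have hij : i ≠ j := by
        rintro rfl; exact hi hy2
      simp [hij]
    have hconv : Convex ℝ {x | T.coord i x = 0} :=
      (convex_singleton (0 : ℝ)).affine_preimage (T.coord i)
    exact convexHull_min hsub hconv hx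
  constructor
  · by_contra h
    have := key 0 h
    rw [hc0] at this
    linarith [ht.2]
  · by_contra h
    have := key 1 h
    rw [hc1] at this
    exact ht.1.ne' this

/-- Near an interior point of an edge of only one element, the triangulation does not meet the other
side of the edge. -/
theorem eventually_notMem_closure {s₁ : Finset Plane} (h₁ : s₁ ∈ 𝒯.elements)
    {T : AffineBasis (Fin 3) ℝ Plane} (hT : (s₁ : Set Plane) = Set.range T)
    (honly : ∀ s ∈ 𝒯.elements, T 0 ∈ s → T 1 ∈ s → s = s₁) {t₀ : ℝ}
    (ht₀ : t₀ ∈ Set.Ioo (0 : ℝ) 1) :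
    ∀ᶠ p : ℝ × ℝ in 𝓝 (t₀, 0), p.2 < 0 →
      affineParam (T 0) (T 1 - T 0) (T 2 - T 0) p ∉ closure Ω := by
  have hall : ∀ᶠ p : ℝ × ℝ in 𝓝 (t₀, 0), ∀ s ∈ 𝒯.faces, p.2 < 0 →
      affineParam (T 0) (T 1 - T 0) (T 2 - T 0) p ∉ convexHull ℝ (s : Set Plane) := by
    rw [eventually_all_finite 𝒯.finite_faces]
    intro s hs
    by_cases hx : affineParam (T 0) (T 1 - T 0) (T 2 - T 0) (t₀, 0) ∈ convexHull ℝ (s : Set Plane)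
    · obtain ⟨h0, h1⟩ := mem_face_of_lineMap_mem h₁ hs hT ht₀ hx
      refine Eventually.of_forall fun p hp hmem => ?_
      -- The face is the edge or the element, where the third barycentric coordinate is nonnegative.
      have hsub : (s : Set Plane) ⊆ {x | 0 ≤ T.coord 2 x} := by
        have hsub' : ({T 0, T 1} : Finset Plane) ⊆ s := by
          intro x hx
          simp only [Finset.mem_insert, Finset.mem_singleton] at hx
          rcases hx with rfl | rfl <;> assumption
        have hcard2 : ({T 0, T 1} : Finset Plane).card = 2 :=
          Finset.card_pair (T.ind.injective.ne (by decide))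
        have hle : s.card ≤ 3 := by
          have := (𝒯.indep hs).card_le_finrank_succ
          have h2 : Module.finrank ℝ (vectorSpan ℝ (Set.range ((↑) : s → Plane))) ≤ 2 :=
            (Submodule.finrank_le _).trans (by simp)
          rw [Fintype.card_coe] at this
          omega
        have hge := Finset.card_le_card hsub'
        rcases Nat.lt_or_ge s.card 3 with hlt | hge3
        · have : ({T 0, T 1} : Finset Plane) = s :=
            Finset.eq_of_subset_of_card_le hsub' (by omega)
          rw [← this]
          intro x hx
          simp only [Finset.coe_insert, Finset.coe_singleton, Set.mem_insert_iff,
            Set.mem_singleton_iff] at hx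
          rcases hx with rfl | rfl <;> simp
        · have hel : s ∈ 𝒯.elements :=
            Finset.mem_filter.2 ⟨by simpa using hs, le_antisymm hle hge3⟩
          rw [honly s hel h0 h1, hT]
          rintro x ⟨i, rfl⟩
          simp only [Set.mem_ofPred_eq, AffineBasis.coord_apply]
          split_ifs <;> norm_num
      have hconv : Convex ℝ {x | 0 ≤ T.coord 2 x} :=
        (convex_Ici (0 : ℝ)).affine_preimage (T.coord 2)
      have := convexHull_min hsub hconv hmem
      rw [Set.mem_ofPred_eq, coord_affineParam] at this
      simp at this
      linarith
    · have hcl : IsClosed (convexHull ℝ (s : Set Plane)) :=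
        (s.finite_toSet.isCompact_convexHull (𝕜 := ℝ)).isClosed
      have := (continuous_affineParam (T 0) (T 1 - T 0) (T 2 - T 0)).continuousAt.eventually
        (hcl.isOpen_compl.mem_nhds hx)
      filter_upwards [this] with p hp _ using hp
  filter_upwards [hall] with p hp hneg hmem
  rw [← 𝒯.space_eq] at hmem
  obtain ⟨s, hs, hmem⟩ := Geometry.SimplicialComplex.mem_space_iff.1 hmem
  exact hp s hs hneg hmem

theorem interior_subset_of_mem_elements (hΩ : interior (closure Ω) = Ω) {s : Finset Plane}
    (hs : s ∈ 𝒯.elements) : interior (convexHull ℝ (s : Set Plane)) ⊆ Ω := by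
  have h : convexHull ℝ (s : Set Plane) ⊆ closure Ω := by
    rw [← 𝒯.space_eq]
    exact Geometry.SimplicialComplex.convexHull_subset_space (mem_faces hs)
  exact (interior_mono h).trans hΩ.subset

end Triangulation

/-- The outward unit normal of an edge of a triangle. -/
theorem exists_isOutwardNormal {s : Finset Plane} {T : AffineBasis (Fin 3) ℝ Plane}
    (hT : (s : Set Plane) = Set.range T) :
    ∃ n, IsOutwardNormal s (T 0) (T 1) n ∧ cross (T 1 - T 0) n ≠ 0 := by
  have hD := cross_ne_zero T
  set u := T 1 - T 0 with hu
  have hu0 : u ≠ 0 := by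
    intro h
    rw [h] at hD
    simp [cross] at hD
  have hn0 := norm_ne_zero_iff.2 hu0
  have hsq : ‖u‖ ^ 2 = u 0 ^ 2 + u 1 ^ 2 := by
    rw [EuclideanSpace.real_norm_sq_eq, Fin.sum_univ_two]
  set ν : Plane := !₂[u 1, -u 0] with hν
  have hνsq : ‖ν‖ ^ 2 = ‖u‖ ^ 2 := by
    rw [hsq, EuclideanSpace.real_norm_sq_eq, Fin.sum_univ_two]
    simp [hν]; ring
  have hνn : ‖ν‖ = ‖u‖ := by
    rwa [sq_eq_sq₀ (norm_nonneg _) (norm_nonneg _)] at hνsq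
  have hin : ∀ w, inner ℝ ν w = -cross u w := by
    intro w
    simp [hν, cross, PiLp.inner_apply, Fin.sum_univ_two]; ring
  have hsgn : ∃ σ : ℝ, |σ| = 1 ∧ σ * cross u (T 2 - T 0) = |cross u (T 2 - T 0)| := by
    rcases abs_cases (cross u (T 2 - T 0)) with ⟨h, -⟩ | ⟨h, -⟩
    · exact ⟨1, by simp, by rw [h, one_mul]⟩
    · exact ⟨-1, by simp, by rw [h, neg_one_mul]⟩
  obtain ⟨σ, hσ, hσD⟩ := hsgn
  have hσ0 : σ ≠ 0 := by
    rintro rfl; simp at hσ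
  refine ⟨(σ / ‖u‖) • ν, ⟨?_, ?_, fun x hx => ?_⟩, ?_⟩
  · rw [norm_smul, hνn, norm_div, norm_norm, Real.norm_eq_abs, hσ]
    field_simp
  · rw [inner_smul_left, hin, cross_self]; simp
  · rw [← Finset.mem_coe, hT] at hx
    obtain ⟨i, rfl⟩ := hx
    rw [inner_smul_left, hin]
    fin_cases i
    · simp [cross]
    · change _ * -cross u u ≤ 0
      rw [cross_self]; simp
    · change (σ / ‖u‖) * -cross u (T 2 - T 0) ≤ 0
      rw [mul_neg, div_mul_eq_mul_div, hσD]
      exact neg_nonpos.2 (by positivity)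
  · have h1 : cross u ((σ / ‖u‖) • ν) = -(σ / ‖u‖) * ‖u‖ ^ 2 := by
      rw [hsq]
      simp only [cross, hν, PiLp.smul_apply, smul_eq_mul]
      simp; ring
    rw [h1]
    exact mul_ne_zero (neg_ne_zero.2 (div_ne_zero hσ0 hn0)) (pow_ne_zero 2 hn0)

/-! ### Traces of functions in `H¹₀` -/

/-- The strip of the points with affine coordinates in `(t₀ - r, t₀ + r) × (α, β)`. -/
def strip (a u w : Plane) (t₀ r α β : ℝ) : Set Plane :=
  affineParam a u w '' (Set.Ioo (t₀ - r) (t₀ + r) ×ˢ Set.Ioo α β)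

theorem setIntegral_strip {a u w : Plane} (h : cross u w ≠ 0) (t₀ r α β : ℝ) (H : Plane → ℝ) :
    ∫ x in strip a u w t₀ r α β, H x =
      |cross u w| * ∫ p in Set.Ioo (t₀ - r) (t₀ + r) ×ˢ Set.Ioo α β, H (affineParam a u w p) := by
  rw [setIntegral_eq_affineParam h, strip, Set.preimage_image_eq _ (affineParam_injective h)]

theorem volume_strip {a u w : Plane} (h : cross u w ≠ 0) (t₀ r α β : ℝ) :
    volume (strip a u w t₀ r α β) = ENNReal.ofReal |cross u w| *
      (ENNReal.ofReal (2 * r) * ENNReal.ofReal (β - α)) := by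
  have h1 := (measurableEmbedding_affineParam (a := a) h).map_apply volume
    (strip a u w t₀ r α β)
  rw [map_affineParam_volume h, strip, Set.preimage_image_eq _ (affineParam_injective h),
    Measure.volume_eq_prod, Measure.prod_prod, Real.volume_Ioo, Real.volume_Ioo,
    Measure.smul_apply, smul_eq_mul] at h1
  rw [strip, show 2 * r = t₀ + r - (t₀ - r) by ring, ← h1, ← mul_assoc,
    ← ENNReal.ofReal_mul (abs_nonneg _), mul_inv_cancel₀ (abs_ne_zero.2 h), ENNReal.ofReal_one,
    one_mul]

theorem integrable_rectangle {H : ℝ × ℝ → ℝ} (hH : Continuous H) (a b c d : ℝ) :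
    Integrable H ((volume.restrict (Set.Ioo a b)).prod (volume.restrict (Set.Ioo c d))) := by
  rw [Measure.prod_restrict, ← Measure.volume_eq_prod]
  exact (hH.continuousOn.integrableOn_compact (isCompact_Icc.prod isCompact_Icc)).mono_set
    (Set.prod_mono Set.Ioo_subset_Icc_self Set.Ioo_subset_Icc_self)

theorem setIntegral_rectangle {H : ℝ × ℝ → ℝ} (hH : Continuous H) (a b c d : ℝ) :
    ∫ p in Set.Ioo a b ×ˢ Set.Ioo c d, H p = ∫ s in Set.Ioo a b, ∫ t in Set.Ioo c d, H (s, t) := by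
  rw [← integral_prod _ (integrable_rectangle hH a b c d), Measure.prod_restrict,
    ← Measure.volume_eq_prod]

/-- The integrals of a function over two adjacent intervals of length `δ` differ at most by `δ`
times the total variation. -/
theorem abs_integral_sub_integral_le {h h' : ℝ → ℝ} (hd : ∀ t, HasDerivAt h (h' t) t)
    (hc : Continuous h') {δ : ℝ} (hδ : 0 < δ) :
    |(∫ t in (0 : ℝ)..δ, h t) - ∫ t in (-δ)..0, h t| ≤ δ * ∫ t in (-δ)..δ, |h' t| := by
  have hcont : Continuous h := continuous_iff_continuousAt.2 fun t => (hd t).continuousAt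
  have h1 : ∫ t in (-δ)..0, h t = ∫ t in (0 : ℝ)..δ, h (t - δ) := by
    simp [intervalIntegral.integral_comp_sub_right]
  have hcont' : Continuous fun t => h (t - δ) := by fun_prop
  rw [h1, ← intervalIntegral.integral_sub (hcont.intervalIntegrable _ _)
    (hcont'.intervalIntegrable _ _)]
  have h2 : ∀ t ∈ Set.uIoc (0 : ℝ) δ, ‖h t - h (t - δ)‖ ≤ ∫ t in (-δ)..δ, |h' t| := by
    intro t ht
    rw [Set.uIoc_of_le hδ.le] at ht
    rw [← intervalIntegral.integral_eq_sub_of_hasDerivAt (fun t _ => hd t)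
      (hc.intervalIntegrable _ _)]
    refine (intervalIntegral.norm_integral_le_integral_norm (by linarith)).trans ?_
    refine intervalIntegral.integral_mono_interval (by linarith [ht.1]) (by linarith) ht.2
      (Eventually.of_forall fun t => abs_nonneg _) (hc.abs.intervalIntegrable _ _)
  have h3 := intervalIntegral.norm_integral_le_of_norm_le_const h2
  rwa [sub_zero, abs_of_pos hδ, mul_comm] at h3

theorem abs_setIntegral_strip_sub_le {a u w : Plane} (h : cross u w ≠ 0) {φ : Plane → ℝ}
    (hφ : ContDiff ℝ ∞ φ) (t₀ r : ℝ) {δ : ℝ} (hδ : 0 < δ) :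
    |(∫ x in strip a u w t₀ r 0 δ, φ x) - ∫ x in strip a u w t₀ r (-δ) 0, φ x| ≤
      δ * ∫ x in strip a u w t₀ r (-δ) δ, |dirDeriv w φ x| := by
  have hc := continuous_affineParam a u w
  have hφc := hφ.continuous.comp hc
  have hdc := ((contDiff_dirDeriv hφ w).continuous.comp hc).abs
  rw [setIntegral_strip h, setIntegral_strip h, setIntegral_strip h, ← mul_sub, abs_mul, abs_abs,
    mul_left_comm]
  refine mul_le_mul_of_nonneg_left ?_ (abs_nonneg _)
  have e1 := setIntegral_rectangle hφc (t₀ - r) (t₀ + r) 0 δ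
  have e2 := setIntegral_rectangle hφc (t₀ - r) (t₀ + r) (-δ) 0
  have e3 := setIntegral_rectangle hdc (t₀ - r) (t₀ + r) (-δ) δ
  have i1 := (integrable_rectangle hφc (t₀ - r) (t₀ + r) 0 δ).integral_prod_left
  have i2 := (integrable_rectangle hφc (t₀ - r) (t₀ + r) (-δ) 0).integral_prod_left
  have i3 := (integrable_rectangle hdc (t₀ - r) (t₀ + r) (-δ) δ).integral_prod_left
  simp only [Function.comp_apply] at e1 e2 e3 i1 i2 i3
  rw [e1, e2, e3, ← integral_sub i1 i2, ← integral_const_mul]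
  refine abs_integral_le_integral_abs.trans ?_
  refine integral_mono (i1.sub i2).abs (i3.const_mul δ) fun s => ?_
  simp only
  have hd : ∀ t : ℝ, HasDerivAt (fun t => φ (affineParam a u w (s, t)))
      (dirDeriv w φ (affineParam a u w (s, t))) t := fun t =>
    hasDerivAt_comp_line hφ (a + s • u) w t
  have hmain := abs_integral_sub_integral_le hd
    ((contDiff_dirDeriv hφ w).continuous.comp (hc.comp (Continuous.prodMk_right s))) hδ
  rwa [intervalIntegral.integral_of_le hδ.le, intervalIntegral.integral_of_le (by linarith),
    intervalIntegral.integral_of_le (by linarith), integral_Ioc_eq_integral_Ioo,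
    integral_Ioc_eq_integral_Ioo, integral_Ioc_eq_integral_Ioo] at hmain

/-- The estimate of the integrals over adjacent strips for functions in `H¹₀(Ω)`, extended by
zero. -/
theorem exists_abs_setIntegral_strip_sub_le {Ω : Set Plane} (hΩ : IsOpen Ω)
    (hfin : volume Ω ≠ ⊤) {v : Plane → ℝ} (hv : MemH10 Ω v) {u w : Plane} (h : cross u w ≠ 0) :
    ∃ γ : Plane → ℝ, Integrable γ ∧ ∀ (a : Plane) (t₀ r δ : ℝ), 0 < δ →
      |(∫ x in strip a u w t₀ r 0 δ, Ω.indicator v x) -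
          ∫ x in strip a u w t₀ r (-δ) 0, Ω.indicator v x| ≤
        δ * ∫ x in strip a u w t₀ r (-δ) δ, |γ x| := by
  obtain ⟨hvL, g, hg, φ, hφ, hφv, hφg⟩ := hv
  have hm := hΩ.measurableSet
  have : IsFiniteMeasure (volume.restrict Ω) := isFiniteMeasure_restrict.2 hfin
  have hvi : Integrable (Ω.indicator v) :=
    (integrable_indicator_iff hm).2 (hvL.integrable one_le_two)
  have hgw : MemLp (fun x => inner ℝ (g x) w) 2 (volume.restrict Ω) := hg.inner_const w
  have hγ : Integrable (Ω.indicator fun x => inner ℝ (g x) w) :=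
    (integrable_indicator_iff hm).2 (hgw.integrable one_le_two)
  have hφi : ∀ n, Integrable (φ n) := fun n =>
    (hφ n).1.continuous.integrable_of_hasCompactSupport (hφ n).2.1
  have hdi : ∀ n, Integrable (dirDeriv w (φ n)) := fun n =>
    (contDiff_dirDeriv (hφ n).1 w).continuous.integrable_of_hasCompactSupport
      ((hφ n).2.1.fderiv_apply ℝ w)
  have hφ0 : ∀ n, ∀ x ∉ Ω, φ n x = 0 := fun n x hx =>
    image_eq_zero_of_notMem_tsupport fun h => hx ((hφ n).2.2 h)
  have hd0 : ∀ n, ∀ x ∉ Ω, dirDeriv w (φ n) x = 0 := fun n x hx => by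
    have : x ∉ tsupport (fderiv ℝ (φ n)) := fun h => hx ((hφ n).2.2 (tsupport_fderiv_subset ℝ h))
    rw [dirDeriv, image_eq_zero_of_notMem_tsupport this]
    rfl
  -- Convergence in `L²(Ω)` implies convergence in `L¹` of the extensions by zero.
  have key : ∀ {F : ℕ → Plane → ℝ}, (∀ n, AEStronglyMeasurable (F n) (volume.restrict Ω)) →
      Tendsto (fun n => eLpNorm (F n) 2 (volume.restrict Ω)) atTop (𝓝 0) →
      Tendsto (fun n => eLpNorm (Ω.indicator (F n)) 1 volume) atTop (𝓝 0) := by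
    intro F hF ht
    have hC : (volume.restrict Ω) Set.univ ^ (1 / (1 : ℝ≥0∞).toReal - 1 / (2 : ℝ≥0∞).toReal) ≠ ⊤ :=
      ENNReal.rpow_ne_top_of_nonneg (by norm_num) (measure_ne_top _ _)
    have ht' := ENNReal.Tendsto.mul_const ht (Or.inr hC)
    rw [zero_mul] at ht'
    refine tendsto_of_tendsto_of_tendsto_of_le_of_le tendsto_const_nhds ht' (fun _ => zero_le)
      fun n => ?_
    simp only
    rw [eLpNorm_indicator_eq_eLpNorm_restrict hm]
    exact eLpNorm_le_eLpNorm_mul_rpow_measure_univ one_le_two (hF n)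
  have hφt : Tendsto (fun n => eLpNorm (φ n - Ω.indicator v) 1 volume) atTop (𝓝 0) := by
    refine (key (fun n => ((hφ n).1.continuous.aestronglyMeasurable).sub hvL.1) hφv).congr
      fun n => ?_
    congr 1
    funext x
    by_cases hx : x ∈ Ω <;> simp [hx, hφ0]
  have hdt : Tendsto (fun n => eLpNorm (dirDeriv w (φ n) - Ω.indicator fun x => inner ℝ (g x) w) 1
      volume) atTop (𝓝 0) := by
    have h1 : Tendsto (fun n => eLpNorm (fun x => dirDeriv w (φ n) x - inner ℝ (g x) w) 2
        (volume.restrict Ω)) atTop (𝓝 0) := by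
      have h2 := ENNReal.Tendsto.const_mul hφg (a := ENNReal.ofReal ‖w‖)
        (Or.inr ENNReal.ofReal_ne_top)
      rw [mul_zero] at h2
      refine tendsto_of_tendsto_of_tendsto_of_le_of_le tendsto_const_nhds h2 (fun _ => zero_le)
        fun n => ?_
      refine eLpNorm_le_mul_eLpNorm_of_ae_le_mul (Eventually.of_forall fun x => ?_) 2
      have h3 : dirDeriv w (φ n) x - inner ℝ (g x) w = inner ℝ (gradient (φ n) x - g x) w := by
        rw [inner_sub_left, inner_gradient_left]
        rfl
      rw [h3, mul_comm]
      exact norm_inner_le_norm _ _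
    refine (key (fun n => ((hdi n).1.restrict).sub hgw.1) h1).congr fun n => ?_
    congr 1
    funext x
    by_cases hx : x ∈ Ω <;> simp [hx, hd0]
  refine ⟨Ω.indicator fun x => inner ℝ (g x) w, hγ, fun a t₀ r δ hδ => ?_⟩
  have l1 := fun S : Set Plane =>
    tendsto_setIntegral_of_L1' _ hvi.1 (Eventually.of_forall hφi) hφt S
  have hat : Tendsto (fun n => eLpNorm ((fun x => |dirDeriv w (φ n) x|) -
      fun x => |Ω.indicator (fun x => inner ℝ (g x) w) x|) 1 volume) atTop (𝓝 0) := by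
    refine tendsto_of_tendsto_of_tendsto_of_le_of_le tendsto_const_nhds hdt (fun _ => zero_le)
      fun n => eLpNorm_mono fun x => ?_
    exact abs_abs_sub_abs_le _ _
  have l2 := fun S : Set Plane =>
    tendsto_setIntegral_of_L1' _ hγ.abs.1 (Eventually.of_forall fun n => (hdi n).abs) hat S
  exact le_of_tendsto_of_tendsto' ((l1 _).sub (l1 _)).abs ((l2 _).const_mul δ)
    fun n => abs_setIntegral_strip_sub_le h (hφ n).1 t₀ r hδ

/-- If the integrals of `p₁` and `p₂` over adjacent strips of width `δ` differ by `o(δ)`, then the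
values of `p₁` and `p₂` on the common side of the strips are comparable. By symmetry they agree. -/
theorem le_of_abs_setIntegral_strip_sub_le {a u w : Plane} (h : cross u w ≠ 0) {t₀ r₀ : ℝ}
    (hr₀ : 0 < r₀) {γ : Plane → ℝ} (hγ : Integrable γ) {p₁ p₂ : Plane → ℝ} (hp₁ : Continuous p₁)
    (hp₂ : Continuous p₂)
    (hb : ∀ r δ, r < r₀ → 0 < δ → δ < r₀ →
      |(∫ x in strip a u w t₀ r 0 δ, p₁ x) - ∫ x in strip a u w t₀ r (-δ) 0, p₂ x| ≤
        δ * ∫ x in strip a u w t₀ r (-δ) δ, |γ x|) :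
    p₁ (affineParam a u w (t₀, 0)) ≤ p₂ (affineParam a u w (t₀, 0)) := by
  by_contra! hlt
  set A := p₁ (affineParam a u w (t₀, 0))
  set B := p₂ (affineParam a u w (t₀, 0))
  set d := A - B with hd
  have hd0 : 0 < d := sub_pos.2 hlt
  have hc := continuous_affineParam a u w
  have h1 : ∀ᶠ p in 𝓝 (t₀, (0 : ℝ)), A - d / 4 < p₁ (affineParam a u w p) :=
    (hp₁.comp hc).continuousAt.eventually_const_lt (by simp only [Function.comp_apply]; linarith)
  have h2 : ∀ᶠ p in 𝓝 (t₀, (0 : ℝ)), p₂ (affineParam a u w p) < B + d / 4 :=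
    (hp₂.comp hc).continuousAt.eventually_lt_const (by simp only [Function.comp_apply]; linarith)
  obtain ⟨ε, hε, hball⟩ := Metric.eventually_nhds_iff.1 (h1.and h2)
  set r := min ε (r₀ / 2) with hr
  have hr0 : 0 < r := lt_min hε (by linarith)
  have hrr : r < r₀ := (min_le_right _ _).trans_lt (by linarith)
  have hin : ∀ p : ℝ × ℝ, p.1 ∈ Set.Ioo (t₀ - r) (t₀ + r) → p.2 ∈ Set.Ioo (-r) r →
      A - d / 4 < p₁ (affineParam a u w p) ∧ p₂ (affineParam a u w p) < B + d / 4 := by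
    intro p hp1 hp2
    refine hball ?_
    have hrε : r ≤ ε := min_le_left _ _
    rw [Prod.dist_eq, max_lt_iff, Real.dist_eq, Real.dist_eq, abs_lt, abs_lt]
    refine ⟨⟨?_, ?_⟩, ?_, ?_⟩ <;> simp only <;> linarith [hp1.1, hp1.2, hp2.1, hp2.2]
  have hD := abs_pos.2 h
  -- The mean values over the strips differ by at least `d / 2`.
  have hlow : ∀ δ, 0 < δ → δ < r → d * |cross u w| * r ≤
      ∫ x in strip a u w t₀ r (-δ) δ, |γ x| := by
    intro δ hδ hδr
    have hb' := (abs_le.1 (hb r δ hrr hδ (hδr.trans hrr))).2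
    have hvol : ∀ α β : ℝ, α ≤ β →
        volume.real (Set.Ioo (t₀ - r) (t₀ + r) ×ˢ Set.Ioo α β) = 2 * r * (β - α) := by
      intro α β hαβ
      rw [Measure.volume_eq_prod, measureReal_prod_prod, Real.volume_real_Ioo_of_le (by linarith),
        Real.volume_real_Ioo_of_le hαβ]
      ring
    have hmeas : ∀ α β : ℝ, MeasurableSet (Set.Ioo (t₀ - r) (t₀ + r) ×ˢ Set.Ioo α β) := fun α β =>
      measurableSet_Ioo.prod measurableSet_Ioo
    have hint : ∀ {q : Plane → ℝ}, Continuous q → ∀ α β : ℝ,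
        IntegrableOn (fun p => q (affineParam a u w p))
          (Set.Ioo (t₀ - r) (t₀ + r) ×ˢ Set.Ioo α β) := fun hq α β => by
      have := integrable_rectangle (hq.comp hc) (t₀ - r) (t₀ + r) α β
      rwa [Measure.prod_restrict, ← Measure.volume_eq_prod] at this
    have hconst : ∀ c α β : ℝ, IntegrableOn (fun _ => c)
        (Set.Ioo (t₀ - r) (t₀ + r) ×ˢ Set.Ioo α β) := fun c α β => by
      have := integrable_rectangle (continuous_const (y := c)) (t₀ - r) (t₀ + r) α β
      rwa [Measure.prod_restrict, ← Measure.volume_eq_prod] at this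
    have e1 : (A - d / 4) * (2 * r * δ) ≤
        ∫ p in Set.Ioo (t₀ - r) (t₀ + r) ×ˢ Set.Ioo 0 δ, p₁ (affineParam a u w p) := by
      have := setIntegral_mono_on (hconst (A - d / 4) 0 δ) (hint hp₁ 0 δ) (hmeas 0 δ)
        fun p hp => (hin p hp.1 ⟨by linarith [hp.2.1], by linarith [hp.2.2]⟩).1.le
      rw [setIntegral_const, hvol 0 δ hδ.le, smul_eq_mul] at this
      linarith
    have e2 : ∫ p in Set.Ioo (t₀ - r) (t₀ + r) ×ˢ Set.Ioo (-δ) 0, p₂ (affineParam a u w p) ≤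
        (B + d / 4) * (2 * r * δ) := by
      have := setIntegral_mono_on (hint hp₂ (-δ) 0) (hconst (B + d / 4) (-δ) 0) (hmeas (-δ) 0)
        fun p hp => (hin p hp.1 ⟨by linarith [hp.2.1], by linarith [hp.2.2]⟩).2.le
      rw [setIntegral_const, hvol (-δ) 0 (by linarith), smul_eq_mul] at this
      linarith
    rw [setIntegral_strip h, setIntegral_strip h t₀ r (-δ) 0, ← mul_sub] at hb'
    have e3 : d / 2 * (2 * r * δ) ≤
        (∫ p in Set.Ioo (t₀ - r) (t₀ + r) ×ˢ Set.Ioo 0 δ, p₁ (affineParam a u w p)) -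
        ∫ p in Set.Ioo (t₀ - r) (t₀ + r) ×ˢ Set.Ioo (-δ) 0, p₂ (affineParam a u w p) := by
      have : d / 2 * (2 * r * δ) = (A - d / 4) * (2 * r * δ) - (B + d / 4) * (2 * r * δ) := by
        rw [hd]; ring
      linarith
    have e4 := (mul_le_mul_of_nonneg_left e3 hD.le).trans hb'
    refine le_of_mul_le_mul_left (le_trans (le_of_eq ?_) e4) hδ
    ring
  have hlim : Tendsto (fun δ : ℝ => ∫ x in strip a u w t₀ r (-δ) δ, |γ x|) (𝓝[>] 0) (𝓝 0) := by
    refine hγ.abs.tendsto_setIntegral_nhds_zero ?_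
    have hv : (volume ∘ fun δ : ℝ => strip a u w t₀ r (-δ) δ) = fun δ : ℝ =>
        ENNReal.ofReal |cross u w| * (ENNReal.ofReal (2 * r) * ENNReal.ofReal (δ - -δ)) :=
      funext fun δ => volume_strip h t₀ r (-δ) δ
    rw [hv]
    have h0 : Tendsto (fun δ : ℝ => ENNReal.ofReal (δ - -δ)) (𝓝[>] 0) (𝓝 0) := by
      have : Continuous fun δ : ℝ => ENNReal.ofReal (δ - -δ) :=
        ENNReal.continuous_ofReal.comp (by fun_prop)
      exact (this.tendsto' 0 0 (by simp)).mono_left nhdsWithin_le_nhds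
    have h3 := ENNReal.Tendsto.const_mul (ENNReal.Tendsto.const_mul h0
      (a := ENNReal.ofReal (2 * r)) (Or.inr ENNReal.ofReal_ne_top))
      (a := ENNReal.ofReal |cross u w|)
      (Or.inr ENNReal.ofReal_ne_top)
    simpa using h3
  have hpos : 0 < d * |cross u w| * r := by positivity
  refine absurd (ge_of_tendsto hlim ?_) (not_le.2 hpos)
  filter_upwards [Ioo_mem_nhdsGT hr0] with δ hδ using hlow δ hδ.1 hδ.2

/-- The traces of a function in `H¹₀(Ω)`, extended by zero, from both sides of a segment agree. -/
theorem eq_of_ae_eq_on_strips {Ω : Set Plane} (hΩ : IsOpen Ω) (hfin : volume Ω ≠ ⊤)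
    {v : Plane → ℝ} (hv : MemH10 Ω v) {a u w : Plane} (h : cross u w ≠ 0) {t₀ r₀ : ℝ}
    (hr₀ : 0 < r₀) {p₁ p₂ : Plane → ℝ} (hp₁ : Continuous p₁) (hp₂ : Continuous p₂)
    (h₁ : Ω.indicator v =ᵐ[volume.restrict (strip a u w t₀ r₀ 0 r₀)] p₁)
    (h₂ : Ω.indicator v =ᵐ[volume.restrict (strip a u w t₀ r₀ (-r₀) 0)] p₂) :
    p₁ (affineParam a u w (t₀, 0)) = p₂ (affineParam a u w (t₀, 0)) := by
  obtain ⟨γ, hγ, hb⟩ := exists_abs_setIntegral_strip_sub_le hΩ hfin hv h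
  have hmono : ∀ {r α β α' β' : ℝ}, r < r₀ → α' ≤ α → β ≤ β' →
      strip a u w t₀ r α β ⊆ strip a u w t₀ r₀ α' β' := fun hr hα hβ =>
    Set.image_mono (Set.prod_mono (Set.Ioo_subset_Ioo (by linarith) (by linarith))
      (Set.Ioo_subset_Ioo hα hβ))
  have hb' : ∀ r δ, r < r₀ → 0 < δ → δ < r₀ →
      |(∫ x in strip a u w t₀ r 0 δ, p₁ x) - ∫ x in strip a u w t₀ r (-δ) 0, p₂ x| ≤
        δ * ∫ x in strip a u w t₀ r (-δ) δ, |γ x| := by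
    intro r δ hr hδ hδr
    have := hb a t₀ r δ hδ
    rwa [integral_congr_ae (ae_restrict_of_ae_restrict_of_subset (hmono hr le_rfl hδr.le) h₁),
      integral_congr_ae (ae_restrict_of_ae_restrict_of_subset (hmono hr (by linarith) le_rfl) h₂)]
      at this
  refine le_antisymm (le_of_abs_setIntegral_strip_sub_le h hr₀ hγ hp₁ hp₂ hb') ?_
  have := le_of_abs_setIntegral_strip_sub_le h hr₀ hγ hp₁.neg hp₂.neg fun r δ hr hδ hδr => by
    have e : ∀ (S : Set Plane) (q : Plane → ℝ), ∫ x in S, (-q) x = -∫ x in S, q x :=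
      fun S q => integral_neg q
    rw [e, e, ← neg_sub', abs_neg]
    exact hb' r δ hr hδ hδr
  exact neg_le_neg_iff.1 this

/-! ### Cancellation of the edge contributions -/

theorem affineParam_zero_right (a b w : Plane) (t : ℝ) :
    affineParam a (b - a) w (t, 0) = AffineMap.lineMap a b t := by
  rw [AffineMap.lineMap_apply, vsub_eq_sub, vadd_eq_add, affineParam]
  module

theorem exists_rectangle_of_eventually {t₀ : ℝ} {P : ℝ × ℝ → Prop}
    (h : ∀ᶠ p in 𝓝 (t₀, (0 : ℝ)), P p) :
    ∃ r > 0, ∀ p ∈ Set.Ioo (t₀ - r) (t₀ + r) ×ˢ Set.Ioo (-r) r, P p := by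
  obtain ⟨r, hr, hball⟩ := Metric.eventually_nhds_iff.1 h
  refine ⟨r, hr, fun p hp => hball ?_⟩
  rw [Prod.dist_eq, max_lt_iff, Real.dist_eq, Real.dist_eq, abs_lt, abs_lt]
  refine ⟨⟨?_, ?_⟩, ?_, ?_⟩ <;> simp only <;> linarith [hp.1.1, hp.1.2, hp.2.1, hp.2.2]

/-- The derivatives along an edge are determined by the restriction to the edge. -/
theorem dirDeriv_lineMap {p : Plane → ℝ} (hp : ContDiff ℝ ∞ p) {a b : Plane} {G : Polynomial ℝ}
    (hG : ∀ t, p (AffineMap.lineMap a b t) = G.eval t) (t : ℝ) :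
    dirDeriv (b - a) p (AffineMap.lineMap a b t) = G.derivative.eval t := by
  have hl : ∀ t : ℝ, (AffineMap.lineMap a b t : Plane) = a + t • (b - a) := fun t => by
    rw [AffineMap.lineMap_apply, vsub_eq_sub, vadd_eq_add, add_comm]
  have h := hasDerivAt_comp_line hp a (b - a) t
  simp only [← hl, hG] at h
  exact h.unique (G.hasDerivAt t)

theorem boundaryDensity_add_smul {p : Plane → ℝ} (hp : ContDiff ℝ ∞ p) (u n x : Plane)
    (α β : ℝ) : boundaryDensity u (α • n + β • u) p x = α * boundaryDensity u n p x := by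
  simp only [boundaryDensity, dirDeriv_add_smul, dirDeriv_dirDeriv_add_smul hp]
  ring

theorem edgeTerm_eq_zero_of_trace_eq_zero {p : Plane → ℝ} (hp : ContDiff ℝ ∞ p) {a b : Plane}
    (h : ∀ t : ℝ, p (AffineMap.lineMap a b t) = 0) (c : Plane) : edgeTerm p a b c = 0 := by
  have h1 := dirDeriv_lineMap hp (G := 0) (by simpa using h)
  have h2 := dirDeriv_lineMap (contDiff_dirDeriv hp (b - a)) h1
  rw [edgeTerm]
  simp [boundaryDensity, h1, h2]

/-- On an edge shared by two triangles on opposite sides, the contributions to Green's formula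
combine to the integral of `J g'' - J' g'`, where `J` is the jump of a transversal derivative and
`g` is the common trace. If `J` vanishes at the endpoints, this equals twice the integral of
`J g''`. -/
theorem edgeTerm_add_edgeTerm_eq_zero {p₁ p₂ : Plane → ℝ} (hp₁ : ContDiff ℝ ∞ p₁)
    (hp₂ : ContDiff ℝ ∞ p₂) {a b c₁ c₂ n : Plane} (hn : cross (b - a) n ≠ 0)
    (hneg : cross (b - a) (c₁ - a) * cross (b - a) (c₂ - a) < 0) {G : Polynomial ℝ}
    (hG₁ : ∀ t, p₁ (AffineMap.lineMap a b t) = G.eval t)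
    (hG₂ : ∀ t, p₂ (AffineMap.lineMap a b t) = G.eval t)
    (ha : dirDeriv n p₁ a = dirDeriv n p₂ a) (hb : dirDeriv n p₁ b = dirDeriv n p₂ b)
    (hJ : ∫ t in (0 : ℝ)..1, (dirDeriv n p₁ (AffineMap.lineMap a b t) -
      dirDeriv n p₂ (AffineMap.lineMap a b t)) * G.derivative.derivative.eval t = 0) :
    edgeTerm p₁ a b c₁ + edgeTerm p₂ a b c₂ = 0 := by
  have hD₁ : cross (b - a) (c₁ - a) ≠ 0 := left_ne_zero_of_mul hneg.ne
  have hD₂ : cross (b - a) (c₂ - a) ≠ 0 := right_ne_zero_of_mul hneg.ne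
  set D₁ := cross (b - a) (c₁ - a) with hD₁'
  set D₂ := cross (b - a) (c₂ - a) with hD₂'
  set κ := cross (b - a) n
  -- The transversal directions are replaced by multiples of `n`.
  have hQ : ∀ {p : Plane → ℝ}, ContDiff ℝ ∞ p → ∀ c : Plane, edgeTerm p a b c =
      |cross (b - a) (c - a)|⁻¹ * (cross (b - a) (c - a) / κ) *
        ∫ t in (0 : ℝ)..1, boundaryDensity (b - a) n p (AffineMap.lineMap a b t) := by
    intro p hp c
    rw [edgeTerm, mul_assoc, ← intervalIntegral.integral_const_mul (cross (b - a) (c - a) / κ)]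
    congr 1
    refine intervalIntegral.integral_congr fun t _ => ?_
    conv_lhs => rw [eq_smul_add_smul hn (c - a)]
    exact boundaryDensity_add_smul hp _ _ _ _ _
  have hsign : |D₂|⁻¹ * (D₂ / κ) = -(|D₁|⁻¹ * (D₁ / κ)) := by
    rcases lt_or_gt_of_ne hD₁ with h1 | h1
    · have h2 : 0 < D₂ := by nlinarith
      rw [abs_of_neg h1, abs_of_pos h2]
      field_simp
    · have h2 : D₂ < 0 := by nlinarith
      rw [abs_of_pos h1, abs_of_neg h2]
      field_simp
  have hcl : Continuous fun t : ℝ => (AffineMap.lineMap a b t : Plane) :=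
    AffineMap.lineMap_continuous
  have hl : ∀ t : ℝ, (AffineMap.lineMap a b t : Plane) = a + t • (b - a) := fun t => by
    rw [AffineMap.lineMap_apply, vsub_eq_sub, vadd_eq_add, add_comm]
  have hc : ∀ {p : Plane → ℝ}, ContDiff ℝ ∞ p →
      Continuous fun t : ℝ => boundaryDensity (b - a) n p (AffineMap.lineMap a b t) := fun hp =>
    (continuous_boundaryDensity hp _ _).comp hcl
  rw [hQ hp₁, hQ hp₂, hsign, neg_mul, ← sub_eq_add_neg, ← mul_sub,
    ← intervalIntegral.integral_sub ((hc hp₁).intervalIntegrable _ _)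
      ((hc hp₂).intervalIntegrable _ _)]
  refine mul_eq_zero_of_right _ ?_
  set J : ℝ → ℝ := fun t => dirDeriv n p₁ (AffineMap.lineMap a b t) -
    dirDeriv n p₂ (AffineMap.lineMap a b t) with hJdef
  set J' : ℝ → ℝ := fun t => dirDeriv (b - a) (dirDeriv n p₁) (AffineMap.lineMap a b t) -
    dirDeriv (b - a) (dirDeriv n p₂) (AffineMap.lineMap a b t) with hJ'def
  have hJd : ∀ t, HasDerivAt J (J' t) t := by
    intro t
    have h1 := hasDerivAt_comp_line (contDiff_dirDeriv hp₁ n) a (b - a) t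
    have h2 := hasDerivAt_comp_line (contDiff_dirDeriv hp₂ n) a (b - a) t
    simp only [← hl] at h1 h2
    exact h1.sub h2
  have hJc : Continuous J := continuous_iff_continuousAt.2 fun t => (hJd t).continuousAt
  have hJ'c : Continuous J' :=
    ((contDiff_dirDeriv (contDiff_dirDeriv hp₁ n) (b - a)).continuous.comp hcl).sub
      ((contDiff_dirDeriv (contDiff_dirDeriv hp₂ n) (b - a)).continuous.comp hcl)
  have d1 := dirDeriv_lineMap hp₁ hG₁
  have d2 := dirDeriv_lineMap hp₂ hG₂
  have dd1 := dirDeriv_lineMap (contDiff_dirDeriv hp₁ (b - a)) d1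
  have dd2 := dirDeriv_lineMap (contDiff_dirDeriv hp₂ (b - a)) d2
  have hparts : ∫ t in (0 : ℝ)..1, (J' t * G.derivative.eval t +
      J t * G.derivative.derivative.eval t) = 0 := by
    rw [intervalIntegral.integral_eq_sub_of_hasDerivAt
      (fun t _ => (hJd t).mul (G.derivative.hasDerivAt t))]
    · simp [hJdef, ha, hb]
    · refine Continuous.intervalIntegrable ?_ _ _
      fun_prop
  have hfin : ∀ t, boundaryDensity (b - a) n p₁ (AffineMap.lineMap a b t) -
      boundaryDensity (b - a) n p₂ (AffineMap.lineMap a b t) =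
      2 * (J t * G.derivative.derivative.eval t) -
        (J' t * G.derivative.eval t + J t * G.derivative.derivative.eval t) := by
    intro t
    simp only [boundaryDensity, d1, d2, dd1, dd2, hJdef, hJ'def]
    ring
  simp only [hfin]
  rw [intervalIntegral.integral_sub, hparts, intervalIntegral.integral_const_mul, hJ]
  · ring
  all_goals
    refine Continuous.intervalIntegrable ?_ _ _
    fun_prop

namespace Triangulation

variable {Ω : Set Plane} {𝒯 : Triangulation Ω}

theorem volume_ne_top (𝒯 : Triangulation Ω) : volume Ω ≠ ⊤ := by
  have h : IsCompact (closure Ω) := by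
    rw [← 𝒯.space_eq]
    exact 𝒯.finite_faces.isCompact_biUnion fun s _ =>
      s.finite_toSet.isCompact_convexHull (𝕜 := ℝ)
  exact ((measure_mono subset_closure).trans_lt h.measure_lt_top).ne

theorem indicator_ae_eq_piece (hΩ : interior (closure Ω) = Ω) {ℓ : ℕ} {v : Plane → ℝ}
    (hv : v ∈ 𝒯.feSpace ℓ) {s : Finset Plane} (hs : s ∈ 𝒯.elements) {S : Set Plane}
    (hS : S ⊆ interior (convexHull ℝ (s : Set Plane))) :
    Ω.indicator v =ᵐ[volume.restrict S] piece v s := by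
  refine ae_restrict_of_ae_restrict_of_subset hS ?_
  have h1 : v =ᵐ[volume.restrict (interior (convexHull ℝ (s : Set Plane)))] piece v s :=
    ae_restrict_of_ae_restrict_of_subset interior_subset (piece_spec hv hs).2
  filter_upwards [h1, ae_restrict_mem isOpen_interior.measurableSet] with x hx hmem
  rw [Set.indicator_of_mem (interior_subset_of_mem_elements hΩ hs hmem), hx]

theorem isOpen_of_interior_closure (hΩ : interior (closure Ω) = Ω) : IsOpen Ω :=
  hΩ ▸ isOpen_interior

/-- The pieces on two elements agree on a shared edge. -/
theorem piece_lineMap_eq (hΩ : interior (closure Ω) = Ω) {ℓ : ℕ} {v : Plane → ℝ}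
    (hv : v ∈ 𝒯.feSpace ℓ) {s₁ s₂ : Finset Plane} (h₁ : s₁ ∈ 𝒯.elements) (h₂ : s₂ ∈ 𝒯.elements)
    (hne : s₁ ≠ s₂) {T₁ T₂ : AffineBasis (Fin 3) ℝ Plane} (hT₁ : (s₁ : Set Plane) = Set.range T₁)
    (hT₂ : (s₂ : Set Plane) = Set.range T₂) (h0 : T₁ 0 = T₂ 0) (h1 : T₁ 1 = T₂ 1) {t₀ : ℝ}
    (ht₀ : t₀ ∈ Set.Ioo (0 : ℝ) 1) :
    piece v s₁ (AffineMap.lineMap (T₁ 0) (T₁ 1) t₀) =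
      piece v s₂ (AffineMap.lineMap (T₁ 0) (T₁ 1) t₀) := by
  have hD := cross_ne_zero T₁
  have hpos : 0 < cross (T₂ 1 - T₂ 0) (-(T₁ 2 - T₁ 0)) * cross (T₂ 1 - T₂ 0) (T₂ 2 - T₂ 0) := by
    have h := cross_mul_cross_neg h₁ h₂ hne hT₁ hT₂ h0 h1
    rw [← h0, ← h1]
    have hc : cross (T₁ 1 - T₁ 0) (-(T₁ 2 - T₁ 0)) = -cross (T₁ 1 - T₁ 0) (T₁ 2 - T₁ 0) := by
      simp only [cross, PiLp.neg_apply]; ring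
    rw [hc]
    linarith
  have hev₁ := eventually_mem_interior T₁ (mul_self_pos.2 hD) ht₀
  have hev₂ := eventually_mem_interior T₂ hpos ht₀
  rw [← h0, ← h1] at hev₂
  have hrefl : Tendsto (fun p : ℝ × ℝ => (p.1, -p.2)) (𝓝 (t₀, 0)) (𝓝 (t₀, 0)) :=
    (by fun_prop : Continuous fun p : ℝ × ℝ => (p.1, -p.2)).tendsto' _ _ (by simp)
  obtain ⟨r, hr, hin⟩ := exists_rectangle_of_eventually (hev₁.and (hrefl.eventually hev₂))
  have hmain := eq_of_ae_eq_on_strips (isOpen_of_interior_closure hΩ) 𝒯.volume_ne_top hv.1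
    (a := T₁ 0) (t₀ := t₀) hD hr (contDiff_piece hv h₁ (n := 0)).continuous
    (contDiff_piece hv h₂ (n := 0)).continuous
    (indicator_ae_eq_piece hΩ hv h₁ ?_) (indicator_ae_eq_piece hΩ hv h₂ ?_)
  · rwa [affineParam_zero_right] at hmain
  · rintro x ⟨p, hp, rfl⟩
    rw [hT₁]
    exact (hin p ⟨hp.1, by linarith [hp.2.1], hp.2.2⟩).1 hp.2.1
  · rintro x ⟨p, hp, rfl⟩
    rw [hT₂]
    have := (hin p ⟨hp.1, hp.2.1, by linarith [hp.2.2]⟩).2 (neg_pos.2 hp.2.2)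
    simpa only [affineParam, neg_smul, smul_neg, neg_neg] using this

/-- The piece on an element vanishes on an edge that belongs to no other element. -/
theorem piece_lineMap_eq_zero (hΩ : interior (closure Ω) = Ω) {ℓ : ℕ} {v : Plane → ℝ}
    (hv : v ∈ 𝒯.feSpace ℓ) {s : Finset Plane} (hs : s ∈ 𝒯.elements)
    {T : AffineBasis (Fin 3) ℝ Plane} (hT : (s : Set Plane) = Set.range T)
    (honly : ∀ s' ∈ 𝒯.elements, T 0 ∈ s' → T 1 ∈ s' → s' = s) {t₀ : ℝ}
    (ht₀ : t₀ ∈ Set.Ioo (0 : ℝ) 1) : piece v s (AffineMap.lineMap (T 0) (T 1) t₀) = 0 := by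
  have hD := cross_ne_zero T
  have hev₁ := eventually_mem_interior T (mul_self_pos.2 hD) ht₀
  have hev₂ := eventually_notMem_closure hs hT honly ht₀
  obtain ⟨r, hr, hin⟩ := exists_rectangle_of_eventually (hev₁.and hev₂)
  have hopen := isOpen_of_interior_closure hΩ
  have hmain := eq_of_ae_eq_on_strips hopen 𝒯.volume_ne_top hv.1
    (a := T 0) (t₀ := t₀) hD hr (contDiff_piece hv hs (n := 0)).continuous
    (continuous_const (y := (0 : ℝ))) (indicator_ae_eq_piece hΩ hv hs ?_) ?_
  · rwa [affineParam_zero_right] at hmain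
  · rintro x ⟨p, hp, rfl⟩
    rw [hT]
    exact (hin p ⟨hp.1, by linarith [hp.2.1], hp.2.2⟩).1 hp.2.1
  · have hsub : strip (T 0) (T 1 - T 0) (T 2 - T 0) t₀ r (-r) 0 ⊆ Ωᶜ := by
      rintro x ⟨p, hp, rfl⟩ hx
      exact (hin p ⟨hp.1, hp.2.1, by linarith [hp.2.2]⟩).2 hp.2.2 (subset_closure hx)
    refine ae_restrict_of_ae_restrict_of_subset hsub ?_
    filter_upwards [ae_restrict_mem hopen.measurableSet.compl] with x hx
    exact Set.indicator_of_notMem hx _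

theorem edgeTerm_eq_zero_of_boundary (hΩ : interior (closure Ω) = Ω) {ℓ : ℕ} {v : Plane → ℝ}
    (hv : v ∈ 𝒯.feSpace ℓ) {s : Finset Plane} (hs : s ∈ 𝒯.elements)
    {T : AffineBasis (Fin 3) ℝ Plane} (hT : (s : Set Plane) = Set.range T)
    (honly : ∀ s' ∈ 𝒯.elements, T 0 ∈ s' → T 1 ∈ s' → s' = s) :
    edgeTerm (piece v s) (T 0) (T 1) (T 2) = 0 := by
  have hmem : ∀ i, T i ∈ s := fun i => by
    rw [← Finset.mem_coe, hT]; exact ⟨i, rfl⟩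
  obtain ⟨G, -, hG⟩ := (hasEdgeForm_piece hv hs (hmem 0) (hmem 1)
    (T.ind.injective.ne (by decide))).trace
  have hG0 : G = 0 := Polynomial.eq_zero_of_infinite_isRoot _
    ((Set.Ioo_infinite one_pos).mono fun t ht =>
      (hG t).symm.trans (piece_lineMap_eq_zero hΩ hv hs hT honly ht))
  exact edgeTerm_eq_zero_of_trace_eq_zero (contDiff_piece hv hs) (by simpa [hG0] using hG) _

theorem edgeTerm_add_edgeTerm_eq_zero_of_interior (hΩ : interior (closure Ω) = Ω) {ℓ : ℕ}
    (hℓ : 4 ≤ ℓ) (heven : Even ℓ) {v : Plane → ℝ} (hv : v ∈ 𝒯.feSpace ℓ) {s₁ s₂ : Finset Plane}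
    (h₁ : s₁ ∈ 𝒯.elements) (h₂ : s₂ ∈ 𝒯.elements) (hne : s₁ ≠ s₂)
    {T₁ T₂ : AffineBasis (Fin 3) ℝ Plane} (hT₁ : (s₁ : Set Plane) = Set.range T₁)
    (hT₂ : (s₂ : Set Plane) = Set.range T₂) (h0 : T₁ 0 = T₂ 0) (h1 : T₁ 1 = T₂ 1) :
    edgeTerm (piece v s₁) (T₁ 0) (T₁ 1) (T₁ 2) + edgeTerm (piece v s₂) (T₁ 0) (T₁ 1) (T₂ 2) =
      0 := by
  have hmem₁ : ∀ i, T₁ i ∈ s₁ := fun i => by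
    rw [← Finset.mem_coe, hT₁]; exact ⟨i, rfl⟩
  have hmem₂ : ∀ i, T₂ i ∈ s₂ := fun i => by
    rw [← Finset.mem_coe, hT₂]; exact ⟨i, rfl⟩
  have hab : T₁ 0 ≠ T₁ 1 := T₁.ind.injective.ne (by decide)
  have he : 𝒯.IsInteriorEdge (T₁ 0) (T₁ 1) s₁ s₂ :=
    ⟨hab, h₁, h₂, hne, hmem₁ 0, hmem₁ 1, h0 ▸ hmem₂ 0, h1 ▸ hmem₂ 1⟩
  obtain ⟨G, hGd, hG₁⟩ := (hasEdgeForm_piece hv h₁ he.left_mem₁ he.right_mem₁ hab).trace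
  obtain ⟨G', -, hG₂⟩ := (hasEdgeForm_piece hv h₂ he.left_mem₂ he.right_mem₂ hab).trace
  have hGG : G' = G := Polynomial.eq_of_infinite_eval_eq _ _
    ((Set.Ioo_infinite one_pos).mono fun t ht =>
      (hG₂ t).symm.trans ((piece_lineMap_eq hΩ hv h₁ h₂ hne hT₁ hT₂ h0 h1 ht).symm.trans (hG₁ t)))
  rw [hGG] at hG₂
  obtain ⟨n, hn, hcn⟩ := exists_isOutwardNormal hT₁
  refine edgeTerm_add_edgeTerm_eq_zero (contDiff_piece hv h₁) (contDiff_piece hv h₂) hcn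
    (cross_mul_cross_neg h₁ h₂ hne hT₁ hT₂ h0 h1) hG₁ hG₂
    (sub_eq_zero.1 (normalJump_vertex hv h₁ h₂ he.left_mem₁ he.left_mem₂ n))
    (sub_eq_zero.1 (normalJump_vertex hv h₁ h₂ he.right_mem₁ he.right_mem₂ n))
    (integral_normalJump_mul_eval hℓ heven hv he hn _ ?_)
  refine (Polynomial.natDegree_derivative_le _).trans ?_
  have := Polynomial.natDegree_derivative_le G
  omega

end Triangulation

namespace Triangulation

variable {Ω : Set Plane} {𝒯 : Triangulation Ω}

/-! ### Summation over all elements -/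

/-- The third vertex of a triangle with vertices `a` and `b`, as a combination of all vertices. -/
def thirdVertex (s : Finset Plane) (a b : Plane) : Plane := ∑ z ∈ s, z - a - b

theorem sum_eq_sum_affineBasis {M : Type*} [AddCommMonoid M] {s : Finset Plane}
    {T : AffineBasis (Fin 3) ℝ Plane} (hT : (s : Set Plane) = Set.range T) (f : Plane → M) :
    ∑ z ∈ s, f z = f (T 0) + f (T 1) + f (T 2) := by
  have hs : s = Finset.univ.map ⟨T, T.ind.injective⟩ := by
    rw [← Finset.coe_inj, hT]; simp
  rw [hs, Finset.sum_map, Fin.sum_univ_three]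
  rfl

theorem thirdVertex_eq {s : Finset Plane} {T : AffineBasis (Fin 3) ℝ Plane}
    (hT : (s : Set Plane) = Set.range T) : thirdVertex s (T 0) (T 1) = T 2 := by
  rw [thirdVertex, sum_eq_sum_affineBasis hT]
  abel

/-- Green's formula, summed over both orientations of each edge of an element. -/
theorem two_mul_integral_eq_sum_edgeTerm {ℓ : ℕ} {v : Plane → ℝ} (hv : v ∈ 𝒯.feSpace ℓ)
    {s : Finset Plane} (hs : s ∈ 𝒯.elements) :
    2 * ∫ x in interior (convexHull ℝ (s : Set Plane)),
        (‖hessian (piece v s) x‖ ^ 2 - Laplacian.laplacian (piece v s) x ^ 2) =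
      ∑ a ∈ s, ∑ b ∈ s, if a = b then 0 else edgeTerm (piece v s) a b (thirdVertex s a b) := by
  obtain ⟨T, hT⟩ := exists_affineBasis_range hs
  have hne : ∀ i j : Fin 3, i ≠ j → T i ≠ T j := fun i j h => T.ind.injective.ne h
  have h1 := integral_norm_hessian_sq_sub_laplacian_sq (contDiff_piece hv hs) T
  have h2 := integral_norm_hessian_sq_sub_laplacian_sq (contDiff_piece hv hs)
    (T.reindex (Equiv.swap 1 2))
  have hr : Set.range (T.reindex (Equiv.swap 1 2)) = Set.range T := by
    rw [AffineBasis.coe_reindex, EquivLike.range_comp]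
  have r0 : T.reindex (Equiv.swap 1 2) 0 = T 0 := rfl
  have r1 : T.reindex (Equiv.swap 1 2) 1 = T 2 := rfl
  have r2 : T.reindex (Equiv.swap 1 2) 2 = T 1 := rfl
  rw [hr, r0, r1, r2] at h2
  have hsum : ∑ z ∈ s, z = T 0 + T 1 + T 2 := sum_eq_sum_affineBasis hT fun z => z
  have t01 : thirdVertex s (T 0) (T 1) = T 2 := by rw [thirdVertex, hsum]; abel
  have t10 : thirdVertex s (T 1) (T 0) = T 2 := by rw [thirdVertex, hsum]; abel
  have t02 : thirdVertex s (T 0) (T 2) = T 1 := by rw [thirdVertex, hsum]; abel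
  have t20 : thirdVertex s (T 2) (T 0) = T 1 := by rw [thirdVertex, hsum]; abel
  have t12 : thirdVertex s (T 1) (T 2) = T 0 := by rw [thirdVertex, hsum]; abel
  have t21 : thirdVertex s (T 2) (T 1) = T 0 := by rw [thirdVertex, hsum]; abel
  simp only [sum_eq_sum_affineBasis hT, if_true, hne 0 1 (by decide), hne 1 0 (by decide),
    hne 0 2 (by decide), hne 2 0 (by decide), hne 1 2 (by decide), hne 2 1 (by decide), if_false,
    t01, t10, t02, t20, t12, t21]
  rw [two_mul]
  nth_rewrite 1 [hT]
  nth_rewrite 1 [hT]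
  linarith

/-- The contributions of all elements at a given edge add up to zero. -/
theorem sum_edgeTerm_eq_zero (hΩ : interior (closure Ω) = Ω) {ℓ : ℕ} (hℓ : 4 ≤ ℓ)
    (heven : Even ℓ) {v : Plane → ℝ} (hv : v ∈ 𝒯.feSpace ℓ) {a b : Plane} (hab : a ≠ b) :
    ∑ s ∈ 𝒯.elements, (if a ∈ s ∧ b ∈ s then edgeTerm (piece v s) a b (thirdVertex s a b) else 0) =
      0 := by
  classical
  rw [← Finset.sum_filter]
  set F := 𝒯.elements.filter fun s => a ∈ s ∧ b ∈ s with hF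
  have hFm : ∀ {s}, s ∈ F ↔ s ∈ 𝒯.elements ∧ a ∈ s ∧ b ∈ s := Finset.mem_filter
  have hbasis : ∀ s ∈ F, ∃ T : AffineBasis (Fin 3) ℝ Plane, T 0 = a ∧ T 1 = b ∧
      (s : Set Plane) = Set.range T := fun s hs =>
    exists_affineBasis (hFm.1 hs).1 (hFm.1 hs).2.1 (hFm.1 hs).2.2 hab
  rcases F.eq_empty_or_nonempty with h0 | ⟨s₁, hs₁⟩
  · rw [h0, Finset.sum_empty]
  obtain ⟨T₁, ha₁, hb₁, hT₁⟩ := hbasis s₁ hs₁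
  by_cases h1 : ∀ s ∈ F, s = s₁
  · have hFs : F = {s₁} := Finset.eq_singleton_iff_unique_mem.2 ⟨hs₁, h1⟩
    rw [hFs, Finset.sum_singleton, ← ha₁, ← hb₁, thirdVertex_eq hT₁]
    refine edgeTerm_eq_zero_of_boundary hΩ hv (hFm.1 hs₁).1 hT₁ fun s hs h0 h1' => h1 s ?_
    exact hFm.2 ⟨hs, ha₁ ▸ h0, hb₁ ▸ h1'⟩
  push Not at h1
  obtain ⟨s₂, hs₂, hne⟩ := h1
  obtain ⟨T₂, ha₂, hb₂, hT₂⟩ := hbasis s₂ hs₂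
  -- A third element would lie on the same side of the edge as one of the first two.
  have hFs : F = {s₁, s₂} := by
    ext s
    rw [Finset.mem_insert, Finset.mem_singleton]
    refine ⟨fun hs => ?_, by rintro (rfl | rfl) <;> assumption⟩
    by_contra! hcon
    obtain ⟨T, ha, hb, hT⟩ := hbasis s hs
    have e1 := cross_mul_cross_neg (hFm.1 hs₁).1 (hFm.1 hs₂).1 hne.symm hT₁ hT₂
      (ha₁.trans ha₂.symm) (hb₁.trans hb₂.symm)
    have e2 := cross_mul_cross_neg (hFm.1 hs₁).1 (hFm.1 hs).1 hcon.1.symm hT₁ hT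
      (ha₁.trans ha.symm) (hb₁.trans hb.symm)
    have e3 := cross_mul_cross_neg (hFm.1 hs₂).1 (hFm.1 hs).1 hcon.2.symm hT₂ hT
      (ha₂.trans ha.symm) (hb₂.trans hb.symm)
    rw [ha₁, hb₁] at e1 e2
    rw [ha₂, hb₂] at e3
    have h4 := mul_neg_of_pos_of_neg (mul_pos_of_neg_of_neg e1 e2) e3
    refine h4.not_ge (le_of_le_of_eq (sq_nonneg (cross (b - a) (T₁ 2 - a) *
      cross (b - a) (T₂ 2 - a) * cross (b - a) (T 2 - a))) ?_)
    ring
  rw [hFs, Finset.sum_pair hne.symm]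
  have := edgeTerm_add_edgeTerm_eq_zero_of_interior hΩ hℓ heven hv (hFm.1 hs₁).1 (hFm.1 hs₂).1
    hne.symm hT₁ hT₂ (ha₁.trans ha₂.symm) (hb₁.trans hb₂.symm)
  rw [← thirdVertex_eq hT₁, ← thirdVertex_eq hT₂, ha₁, hb₁, ha₂, hb₂] at this
  exact this

theorem sum_integral_eq_zero (hΩ : interior (closure Ω) = Ω) {ℓ : ℕ} (hℓ : 4 ≤ ℓ)
    (heven : Even ℓ) {v : Plane → ℝ} (hv : v ∈ 𝒯.feSpace ℓ) :
    ∑ s ∈ 𝒯.elements, ∫ x in interior (convexHull ℝ (s : Set Plane)),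
      (‖hessian (piece v s) x‖ ^ 2 - Laplacian.laplacian (piece v s) x ^ 2) = 0 := by
  classical
  refine (mul_eq_zero.1 ?_).resolve_left (two_ne_zero (α := ℝ))
  rw [Finset.mul_sum, Finset.sum_congr rfl fun s hs => two_mul_integral_eq_sum_edgeTerm hv hs]
  set V := 𝒯.elements.biUnion id with hV
  have hsub : ∀ s ∈ 𝒯.elements, s ⊆ V := fun s hs => Finset.subset_biUnion_of_mem id hs
  have hext : ∀ s ∈ 𝒯.elements,
      (∑ a ∈ s, ∑ b ∈ s, if a = b then 0 else edgeTerm (piece v s) a b (thirdVertex s a b)) =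
      ∑ a ∈ V, ∑ b ∈ V, if a = b then 0 else
        if a ∈ s ∧ b ∈ s then edgeTerm (piece v s) a b (thirdVertex s a b) else 0 := by
    intro s hs
    rw [← Finset.sum_subset (hsub s hs) (fun a _ ha => Finset.sum_eq_zero fun b _ => by simp [ha])]
    refine Finset.sum_congr rfl fun a ha => ?_
    rw [← Finset.sum_subset (hsub s hs) (fun b _ hb => by simp [hb])]
    exact Finset.sum_congr rfl fun b hb => by simp [ha, hb]
  rw [Finset.sum_congr rfl hext, Finset.sum_comm]
  refine Finset.sum_eq_zero fun a _ => ?_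
  rw [Finset.sum_comm]
  refine Finset.sum_eq_zero fun b _ => ?_
  by_cases hab : a = b
  · simp [hab]
  · simpa only [hab, if_false] using sum_edgeTerm_eq_zero hΩ hℓ heven hv hab

/-! ### The norms of the piecewise Hessian and Laplacian -/

theorem disjoint_interior {s₁ s₂ : Finset Plane} (h₁ : s₁ ∈ 𝒯.elements) (h₂ : s₂ ∈ 𝒯.elements)
    (hne : s₁ ≠ s₂) : Disjoint (interior (convexHull ℝ (s₁ : Set Plane)))
      (interior (convexHull ℝ (s₂ : Set Plane))) := by
  rw [Set.disjoint_left]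
  intro x hx₁ hx₂
  obtain ⟨T, hT⟩ := exists_affineBasis_range h₁
  have hx := 𝒯.inter_subset_convexHull (mem_faces h₁) (mem_faces h₂)
    ⟨interior_subset hx₁, interior_subset hx₂⟩
  obtain ⟨z, hz₁, hz₂⟩ : ∃ z ∈ s₁, z ∉ s₂ := by
    by_contra! hcon
    refine hne (Finset.eq_of_subset_of_card_le hcon ?_)
    rw [(Finset.mem_filter.1 h₁).2, (Finset.mem_filter.1 h₂).2]
  rw [← Finset.mem_coe, hT] at hz₁
  obtain ⟨i, rfl⟩ := hz₁
  have hsub : (s₁ ∩ s₂ : Set Plane) ⊆ {x | T.coord i x = 0} := by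
    rintro y ⟨hy1, hy2⟩
    rw [hT] at hy1
    obtain ⟨j, rfl⟩ := hy1
    have hij : i ≠ j := by
      rintro rfl; exact hz₂ hy2
    simp [hij]
  have hconv : Convex ℝ {x | T.coord i x = 0} :=
    (convex_singleton (0 : ℝ)).affine_preimage (T.coord i)
  have h0 : T.coord i x = 0 := convexHull_min hsub hconv hx
  rw [hT, T.interior_convexHull] at hx₁
  exact (hx₁ i).ne' h0

/-- The squared `L²` norm of a piecewise defined function is the sum of the contributions of the
elements. -/
theorem eLpNorm_piecewise_sq {E : Type*} [NormedAddCommGroup E] (hΩ : interior (closure Ω) = Ω)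
    {f : Finset Plane → Plane → E} (hf : ∀ s ∈ 𝒯.elements, Continuous (f s)) :
    eLpNorm (fun x => ∑ s ∈ 𝒯.elements,
        (interior (convexHull ℝ (s : Set Plane))).indicator (f s) x) 2 (volume.restrict Ω) ^ 2 =
      ENNReal.ofReal (∑ s ∈ 𝒯.elements,
        ∫ x in interior (convexHull ℝ (s : Set Plane)), ‖f s x‖ ^ 2) := by
  have hpt : ∀ x, ‖∑ s ∈ 𝒯.elements,
      (interior (convexHull ℝ (s : Set Plane))).indicator (f s) x‖ₑ ^ 2 =
      ∑ s ∈ 𝒯.elements, (interior (convexHull ℝ (s : Set Plane))).indicator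
        (fun x => ‖f s x‖ₑ ^ 2) x := by
    intro x
    by_cases hx : ∃ s ∈ 𝒯.elements, x ∈ interior (convexHull ℝ (s : Set Plane))
    · obtain ⟨s, hs, hx⟩ := hx
      have hother : ∀ s' ∈ 𝒯.elements, s' ≠ s →
          x ∉ interior (convexHull ℝ (s' : Set Plane)) := fun s' hs' hne hx' =>
        Set.disjoint_left.1 (disjoint_interior hs' hs hne) hx' hx
      rw [Finset.sum_eq_single_of_mem s hs fun s' hs' hne =>
          Set.indicator_of_notMem (hother s' hs' hne) _,
        Finset.sum_eq_single_of_mem s hs fun s' hs' hne =>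
          Set.indicator_of_notMem (hother s' hs' hne) _,
        Set.indicator_of_mem hx, Set.indicator_of_mem hx]
    · push Not at hx
      rw [Finset.sum_eq_zero fun s hs => Set.indicator_of_notMem (hx s hs) _,
        Finset.sum_eq_zero fun s hs => Set.indicator_of_notMem (hx s hs) _]
      simp
  have hnorm : ∀ g : Plane → E, eLpNorm g 2 (volume.restrict Ω) ^ 2 = ∫⁻ x in Ω, ‖g x‖ₑ ^ 2 := by
    intro g
    rw [eLpNorm_eq_lintegral_rpow_enorm_toReal (by simp) (by simp), ENNReal.toReal_ofNat,
      ← ENNReal.rpow_natCast, ← ENNReal.rpow_mul]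
    norm_num
  rw [hnorm]
  simp only [hpt]
  rw [lintegral_finsetSum', ENNReal.ofReal_sum_of_nonneg]
  · refine Finset.sum_congr rfl fun s hs => ?_
    rw [lintegral_indicator isOpen_interior.measurableSet,
      Measure.restrict_restrict isOpen_interior.measurableSet,
      Set.inter_eq_self_of_subset_left (interior_subset_of_mem_elements hΩ hs),
      ofReal_integral_eq_lintegral_ofReal]
    · refine lintegral_congr fun x => ?_
      rw [ENNReal.ofReal_pow (norm_nonneg _), ofReal_norm]
    · refine IntegrableOn.mono_set ?_ interior_subset
      exact ((hf s hs).norm.pow 2).continuousOn.integrableOn_compact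
        (s.finite_toSet.isCompact_convexHull (𝕜 := ℝ))
    · exact Eventually.of_forall fun x => by positivity
  · exact fun s _ => integral_nonneg fun x => by positivity
  · intro s hs
    refine (Measurable.indicator ?_ isOpen_interior.measurableSet).aemeasurable
    exact (hf s hs).enorm.measurable.pow_const 2

theorem continuous_hessian {p : Plane → ℝ} (hp : ContDiff ℝ ∞ p) : Continuous (hessian p) := by
  refine (PiLp.continuous_toLp 2 _).comp (continuous_pi fun ij => ?_)
  simp only [iteratedFDeriv_two_eq_dirDeriv hp]
  exact (contDiff_dirDeriv (contDiff_dirDeriv hp _) _).continuous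

theorem continuous_laplacian {p : Plane → ℝ} (hp : ContDiff ℝ ∞ p) :
    Continuous (Laplacian.laplacian p) := by
  rw [InnerProductSpace.laplacian_eq_iteratedFDeriv_orthonormalBasis p
    (EuclideanSpace.basisFun (Fin 2) ℝ)]
  simp only [iteratedFDeriv_two_eq_dirDeriv hp]
  exact continuous_finsetSum _ fun i _ =>
    (contDiff_dirDeriv (contDiff_dirDeriv hp _) _).continuous

theorem strongMirandaTalenti_feSpace (hΩ : interior (closure Ω) = Ω) {ℓ : ℕ} (hℓ : 4 ≤ ℓ)
    (heven : Even ℓ) : 𝒯.StrongMirandaTalenti (𝒯.feSpace ℓ) := by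
  intro v hv
  have hH : ∀ s ∈ 𝒯.elements, Continuous (hessian (piece v s)) := fun s hs =>
    continuous_hessian (contDiff_piece hv hs)
  have hL : ∀ s ∈ 𝒯.elements, Continuous (Laplacian.laplacian (piece v s)) := fun s hs =>
    continuous_laplacian (contDiff_piece hv hs)
  have hi : ∀ {q : Plane → ℝ} (s : Finset Plane), Continuous q →
      IntegrableOn q (interior (convexHull ℝ (s : Set Plane))) := fun s hq =>
    (hq.continuousOn.integrableOn_compact
      (s.finite_toSet.isCompact_convexHull (𝕜 := ℝ))).mono_set interior_subset
  have hsum := sum_integral_eq_zero hΩ hℓ heven hv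
  have hsub : ∀ s ∈ 𝒯.elements, ∫ x in interior (convexHull ℝ (s : Set Plane)),
      (‖hessian (piece v s) x‖ ^ 2 - Laplacian.laplacian (piece v s) x ^ 2) =
      (∫ x in interior (convexHull ℝ (s : Set Plane)), ‖hessian (piece v s) x‖ ^ 2) -
        ∫ x in interior (convexHull ℝ (s : Set Plane)), Laplacian.laplacian (piece v s) x ^ 2 :=
    fun s hs => integral_sub (hi s ((hH s hs).norm.pow 2)) (hi s ((hL s hs).pow 2))
  rw [Finset.sum_congr rfl hsub, Finset.sum_sub_distrib, sub_eq_zero] at hsum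
  rw [← ENNReal.pow_le_pow_left_iff two_ne_zero]
  refine le_of_eq ?_
  refine (eLpNorm_piecewise_sq hΩ hH).trans (Eq.trans ?_ (eLpNorm_piecewise_sq hΩ hL).symm)
  simp only [Real.norm_eq_abs, sq_abs]
  exact congrArg _ hsum

end Triangulation

end MirandaTalenti

end

theorem mainTheorem1 {Ω : Set MirandaTalenti.Plane} (hΩ : interior (closure Ω) = Ω)
    (𝒯 : MirandaTalenti.Triangulation Ω) (ℓ : ℕ) (hℓ : 4 ≤ ℓ) (heven : Even ℓ) :
    (∀ v ∈ 𝒯.feSpace ℓ, 𝒯.NormalMomentContinuity (ℓ - 2) v) ∧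
      𝒯.StrongMirandaTalenti (𝒯.feSpace ℓ) :=
  ⟨fun _ hv => MirandaTalenti.Triangulation.normalMomentContinuity_of_mem_feSpace hℓ heven hv,
    MirandaTalenti.Triangulation.strongMirandaTalenti_feSpace hΩ hℓ heven⟩
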